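/- **Setting.** Let $N\ge 1$, $D>0$, $L\ge 2D$, $\lambda>0$, $G>0$, $P>0$. Let $N$ transmitters be placed in the square $[0,D]\times[0,D]$ and $N$ receivers in the square $[L,L+D]\times[0,D]$ (two horizontally aligned squares of side $D$ whose centers are at distance $L$), all $2N$ positions being independent and uniformly distributed in the respective squares. Let $d_{ik}$ be the Euclidean distance between receiver $i$ and transmitter $k$, and let $H$ be the $N\times N$ matrix with entries $$H_{ik}=\frac{\sqrt G}{d_{ik}}\exp\left(-j\frac{2\pi}{\lambda}d_{ik}\right),\qquad j=\sqrt{-1}.$$ Consider the channel $Y=HX+W+Z$ on $\mathbb{C}^N$, in which $X,W,Z$ are independent, $Z\sim\mathcal{CN}(0,I)$, and the external interference $W$ has an arbitrary law with finite second moments and covariance matrix $\Sigma$. The capacity of the channel is $$C(H)=\sup\{I(X;Y):\ \mathbb{E}|X_i|^2\le P\text{ for all }i\}$$ (in bits; all logarithms below are to base 2), the supremum being over the laws of $X$. Put $$\rho_1=\frac{L^2}{NGP}\operatorname{tr}(\Sigma),\qquad \rho_2=\frac{L^4}{N(GP)^2}\operatorname{tr}(\Sigma^2),\qquad M=\max\left\{1,\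 \frac{D^2}{\lambda L}\left(1+\left(\log\frac{D^2}{\lambda L}\right)^+\right)^{-1}\right\},$$ where $x^+=\max\{x,0\}$. **Theorem.** There are constants $K_1',K_2'>0$, independent of $N,D,L,\lambda,G,P$ and of the law of $W$, such that, with probability tending to $1$ as $N\to\infty$, uniformly in $D,L,\lambda,G,P$ as above (so that these parameters may vary with $N$), the positions of the nodes are such that, for every law of $W$ as above (which may thus depend on the positions) and every $0\le\delta\le1$, $$C(H)\ \ge\ N\,\frac{\delta^2(\rho_1+K_1'N)^2}{\left(\rho_2^{1/2}+\left(K_2'\max\{N^2,N^3M^{-1}\}\right)^{1/2}\right)^2}\ \log\left(1+\frac{\frac{GP}{L^2}\left((1-\delta)K_1'N-\delta\rho_1\right)}{1+\frac{GP}{L^2}\rho_1}\right).$$ -/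

import Mathlib

open MeasureTheory ProbabilityTheory
open scoped ENNReal NNReal Matrix

noncomputable section

/-- The Euclidean plane. -/
abbrev Plane : Type := EuclideanSpace ℝ (Fin 2)

/-- The axis-parallel closed square of side `D` whose lower left corner is `(a, 0)`. -/
def square (a D : ℝ) : Set Plane :=
  {p | a ≤ p 0 ∧ p 0 ≤ a + D ∧ 0 ≤ p 1 ∧ p 1 ≤ D}

/-- The uniform distribution on a set of the plane: normalized Lebesgue measure. -/
def uniformLaw (S : Set Plane) : Measure Plane :=
  ProbabilityTheory.cond volume S

/-- The law of the node positions: `N` transmitters (first component), uniform in the square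
`[0, D] × [0, D]`, and `N` receivers (second component), uniform in the square
`[L, L + D] × [0, D]`; all `2 N` positions are independent. -/
def nodeLaw (N : ℕ) (D L : ℝ) : Measure ((Fin N → Plane) × (Fin N → Plane)) :=
  (Measure.pi fun _ : Fin N => uniformLaw (square 0 D)).prod
    (Measure.pi fun _ : Fin N => uniformLaw (square L D))

/-- The line-of-sight channel matrix with wavelength `wl` and gain constant `G`:
the entry `(i, k)` is `√G / d * exp (-j 2π d / wl)`, where `d` is the Euclidean distance between
receiver `i` and transmitter `k`. -/
def channelMatrix {N : ℕ} (G wl : ℝ) (tx rx : Fin N → Plane) : Matrix (Fin N) (Fin N) ℂ :=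
  Matrix.of fun i k =>
    ((Real.sqrt G / dist (rx i) (tx k) : ℝ) : ℂ) *
      Complex.exp (-Complex.I * ((2 * Real.pi / wl * dist (rx i) (tx k) : ℝ) : ℂ))

/-- The circularly symmetric complex Gaussian law `CN(0, 1)`: independent real and imaginary
parts, each centered with variance `1 / 2`. -/
def complexGaussian : Measure ℂ :=
  ((gaussianReal 0 (1 / 2)).prod (gaussianReal 0 (1 / 2))).map fun p => (⟨p.1, p.2⟩ : ℂ)

/-- The law `CN(0, I)` on `ℂ^N`. -/
def gaussianNoise (N : ℕ) : Measure (Fin N → ℂ) :=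
  Measure.pi fun _ => complexGaussian

/-- The joint law of `(X, Y)` for `Y = H X + W + Z`, where `X ~ μX`, `W ~ μW` and `Z ~ CN(0, I)`
are independent. -/
def jointLaw {N : ℕ} (H : Matrix (Fin N) (Fin N) ℂ) (μW μX : Measure (Fin N → ℂ)) :
    Measure ((Fin N → ℂ) × (Fin N → ℂ)) :=
  (μX.prod (μW.prod (gaussianNoise N))).map fun q => (q.1, H *ᵥ q.1 + q.2.1 + q.2.2)

/-- The mutual information, in bits, of a pair with joint law `π`: the Kullback-Leibler
divergence of `π` from the product of its marginals. -/
def mutualInfo {α β : Type*} [MeasurableSpace α] [MeasurableSpace β]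
    (π : Measure (α × β)) : ℝ≥0∞ :=
  InformationTheory.klDiv π (π.fst.prod π.snd) / ENNReal.ofReal (Real.log 2)

/-- The capacity, in bits, of the channel `Y = H X + W + Z` with interference law `μW`: the
supremum of `I(X; Y)` over all laws of `X` with `E |X_i|² ≤ P` for every `i`. -/
def capacity {N : ℕ} (H : Matrix (Fin N) (Fin N) ℂ) (μW : Measure (Fin N → ℂ)) (P : ℝ) : ℝ≥0∞ :=
  ⨆ (μX : Measure (Fin N → ℂ)) (_ : IsProbabilityMeasure μX)
    (_ : ∀ i, ∫⁻ x, ‖x i‖ₑ ^ 2 ∂μX ≤ ENNReal.ofReal P), mutualInfo (jointLaw H μW μX)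

/-- The covariance matrix `E[(W - E W) (W - E W)^*]` of a random vector `W ~ μW`. -/
def covMatrix {N : ℕ} (μW : Measure (Fin N → ℂ)) : Matrix (Fin N) (Fin N) ℂ :=
  Matrix.of fun i j =>
    ∫ w, (w i - ∫ v, v i ∂μW) * (starRingEnd ℂ) (w j - ∫ v, v j ∂μW) ∂μW

/-- The normalized first moment `ρ₁ = L² tr(Σ) / (N G P)`. -/
def rho1 {N : ℕ} (S : Matrix (Fin N) (Fin N) ℂ) (L G P : ℝ) : ℝ :=
  L ^ 2 / (N * G * P) * S.trace.re

/-- The normalized second moment `ρ₂ = L⁴ tr(Σ²) / (N (G P)²)`. -/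
def rho2 {N : ℕ} (S : Matrix (Fin N) (Fin N) ℂ) (L G P : ℝ) : ℝ :=
  L ^ 4 / (N * (G * P) ^ 2) * (S * S).trace.re

/-- `M = max {1, (D² / (wl L)) (1 + (log₂ (D² / (wl L)))⁺)⁻¹}`. -/
def dofM (D L wl : ℝ) : ℝ :=
  max 1 (D ^ 2 / (wl * L) * (1 + max (Real.logb 2 (D ^ 2 / (wl * L))) 0)⁻¹)

/-- The lower bound for the capacity, in bits, as a function of `δ`, `ρ₁`, `ρ₂`, `N`, `M`,
`g = G P / L²` and the two constants `K₁`, `K₂`. -/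
def rateBound (K₁ K₂ δ ρ₁ ρ₂ N M g : ℝ) : ℝ :=
  N * (δ ^ 2 * (ρ₁ + K₁ * N) ^ 2 /
      (Real.sqrt ρ₂ + Real.sqrt (K₂ * max (N ^ 2) (N ^ 3 * M⁻¹))) ^ 2) *
    Real.logb 2 (1 + g * ((1 - δ) * K₁ * N - δ * ρ₁) / (1 + g * ρ₁))

end

/-! ### Variance of a U-statistic of order two -/

section UStatistic

variable {X : Type*} [MeasurableSpace X] (μ : Measure X) [IsProbabilityMeasure μ] {N : ℕ}

/-! Send a Gaussian vector along the eigenvectors of `Hᴴ * H`, with power P on each, and project the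
output on the left singular vectors. This gives N scalar channels with gains √(P e_i), where e_i are
the eigenvalues, and noise variances at most 1 + σ_i, where σ_i are diagonal entries of the rotated
interference covariance and sum to at most tr Σ. The interference is neither Gaussian nor
independent across these channels, so the information is bounded below by the Donsker-Varadhan
inequality, tested on the log-likelihood ratio that independent Gaussian noise would have. The
expectation of this ratio involves second moments only, and its exponential integrates to one over
the input for every fixed output. Hence C(H) ≥ ∑ log(1 + P e_i / (1 + σ_i)); see
`exists_eigenvalues_sum_logb_le_capacity`.

A Paley-Zygmund argument (`mul_logb_le_sum_logb`) counts the channels of good signal-to-noise ratio,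
given a lower bound for ∑ e_i = tr(H^*H) and an upper bound for ∑ e_i², the squared Frobenius norm
of H^*H. The first bound is deterministic, since all distances are of order L. The second must be of
order (G/L²)² N⁴ max(1/N, 1/M), and only there do the geometry and the randomness of the positions
matter.

Geometry: the mean squared correlation of two random receivers, averaged over the transmitter, is
O(λL/D²) (`integral_norm_sq_gramKernel_truncKernel_le`). Freeze the horizontal coordinates.
Hilbert-Schmidt duality replaces the correlation of points on two vertical receiver lines by
correlations of two transmitters seen from one line at a time. There the path difference has no
stationary point, and one integration by parts gives decay in the inverse separation, whose
truncated square is integrable without a logarithm.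

Probability: `gramKernel_concentration`, a Chebyshev bound for a U-statistic, is applied twice: to
the receivers under the uniform law of a transmitter, and then, given the receivers, to the
transmitters under the empirical measure of the receivers. Duality turns the conclusion of the first
stage into the hypothesis of the second. The resulting event concerns the positions alone, so it
serves all interference laws and all δ at once. -/

lemma iIndepFun_eval_pi : iIndepFun (fun (i : Fin N) (x : Fin N → X) => x i)
    (Measure.pi fun _ : Fin N => μ) :=
  iIndepFun_pi (X := fun _ x => x) (fun _ => aemeasurable_id)

lemma map_eval_pi (k : Fin N) : (Measure.pi fun _ : Fin N => μ).map (fun x => x k) = μ :=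
  (measurePreserving_eval (fun _ : Fin N => μ) k).map_eq

lemma map_pair_pi {k l : Fin N} (h : k ≠ l) :
    (Measure.pi fun _ : Fin N => μ).map (fun x => (x k, x l)) = μ.prod μ := by
  have := ((iIndepFun_eval_pi μ).indepFun h)
  rw [indepFun_iff_map_prod_eq_prod_map_map (measurable_pi_apply k).aemeasurable
    (measurable_pi_apply l).aemeasurable] at this
  rw [this, map_eval_pi, map_eval_pi]

lemma map_triple_pi {k l m : Fin N} (hkl : k ≠ l) (hkm : k ≠ m) (hlm : l ≠ m) :
    (Measure.pi fun _ : Fin N => μ).map (fun x => ((x k, x l), x m)) = (μ.prod μ).prod μ := by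
  have := ((iIndepFun_eval_pi μ).indepFun_prodMk (fun i => by fun_prop) k l m hkm hlm)
  rw [indepFun_iff_map_prod_eq_prod_map_map
    (((measurable_pi_apply k).prodMk (measurable_pi_apply l)).aemeasurable)
    (measurable_pi_apply m).aemeasurable] at this
  rw [this, map_eval_pi, map_pair_pi μ hkl]

variable {κ : X → X → ℝ} {C : ℝ} (hκ : Measurable (Function.uncurry κ))
  (h0 : ∀ x y, 0 ≤ κ x y) (hC : ∀ x y, κ x y ≤ C) (hsymm : ∀ x y, κ x y = κ y x)

include hκ h0 hC in
lemma memLp_kernel_pi (k l : Fin N) :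
    MemLp (fun x : Fin N → X => κ (x k) (x l)) 2 (Measure.pi fun _ : Fin N => μ) := by
  have hm : Measurable (fun x : Fin N → X => κ (x k) (x l)) :=
    hκ.comp (f := fun x : Fin N → X => (x k, x l)) (by fun_prop)
  refine MemLp.of_bound hm.aestronglyMeasurable C (ae_of_all _ fun x => ?_)
  rw [Real.norm_of_nonneg (h0 _ _)]
  exact hC _ _

include hκ in
lemma integral_kernel_pair_pi {k l : Fin N} (h : k ≠ l) :
    ∫ x, κ (x k) (x l) ∂(Measure.pi fun _ : Fin N => μ) = ∫ p, κ p.1 p.2 ∂(μ.prod μ) := by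
  rw [← map_pair_pi μ h]
  exact (integral_map (φ := fun x : Fin N → X => (x k, x l)) (f := Function.uncurry κ)
    (by fun_prop) hκ.aestronglyMeasurable).symm

include hκ h0 hC in
-- Given the shared variable, the two factors are independent with the same conditional mean.
lemma integral_kernel_mul_kernel_pi {k l m : Fin N} (hkl : k ≠ l) (hkm : k ≠ m) (hlm : l ≠ m) :
    ∫ x, κ (x k) (x l) * κ (x k) (x m) ∂(Measure.pi fun _ : Fin N => μ) =
      ∫ x, (∫ y, κ x y ∂μ) ^ 2 ∂μ := by
  have hm : Measurable (fun q : (X × X) × X => κ q.1.1 q.1.2 * κ q.1.1 q.2) :=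
    (hκ.comp (f := fun q : (X × X) × X => (q.1.1, q.1.2)) (by fun_prop)).mul
      (hκ.comp (f := fun q : (X × X) × X => (q.1.1, q.2)) (by fun_prop))
  have h1 : ∫ x, κ (x k) (x l) * κ (x k) (x m) ∂(Measure.pi fun _ : Fin N => μ) =
      ∫ q : (X × X) × X, κ q.1.1 q.1.2 * κ q.1.1 q.2 ∂((μ.prod μ).prod μ) := by
    rw [← map_triple_pi μ hkl hkm hlm, integral_map (by fun_prop) hm.aestronglyMeasurable]
  have hi : Integrable (fun q : (X × X) × X => κ q.1.1 q.1.2 * κ q.1.1 q.2)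
      ((μ.prod μ).prod μ) := by
    refine Integrable.of_bound hm.aestronglyMeasurable (C * C) (ae_of_all _ fun x => ?_)
    rw [Real.norm_of_nonneg (mul_nonneg (h0 _ _) (h0 _ _))]
    exact mul_le_mul (hC _ _) (hC _ _) (h0 _ _) ((h0 _ _).trans (hC x.2 x.2))
  rw [h1, integral_prod _ hi, integral_prod _ hi.integral_prod_left]
  refine integral_congr_ae (ae_of_all _ fun x => ?_)
  simp only [integral_const_mul, integral_mul_const]
  ring

lemma covariance_le_integral_mul {Ω : Type*} [MeasurableSpace Ω] {P : Measure Ω}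
    [IsProbabilityMeasure P] {f g : Ω → ℝ} (hf : MemLp f 2 P) (hg : MemLp g 2 P)
    (hf0 : ∀ x, 0 ≤ f x) (hg0 : ∀ x, 0 ≤ g x) : cov[f, g; P] ≤ ∫ x, f x * g x ∂P := by
  rw [covariance_eq_sub hf hg]
  have := mul_nonneg (integral_nonneg hf0 : 0 ≤ ∫ x, f x ∂P) (integral_nonneg hg0 : 0 ≤ ∫ x, g x ∂P)
  simp only [Pi.mul_apply]
  linarith

include hκ h0 hC hsymm in
-- Disjoint pairs are independent. Otherwise the product of the means, which is nonnegative, is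
-- dropped: one common index leaves the second moment of the conditional mean, two leave that of the
-- kernel. The indicators record every possible coincidence, so that the later sum over pairs is a
-- count.
lemma covariance_kernel_le {p q : Fin N × Fin N} (hp : p.1 ≠ p.2) (hq : q.1 ≠ q.2) :
    cov[fun x => κ (x p.1) (x p.2), fun x => κ (x q.1) (x q.2); Measure.pi fun _ : Fin N => μ] ≤
      (∫ x, (∫ y, κ x y ∂μ) ^ 2 ∂μ) *
        ((if p.1 = q.1 then 1 else 0) + (if p.1 = q.2 then 1 else 0) +
          (if p.2 = q.1 then 1 else 0) + (if p.2 = q.2 then 1 else 0)) +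
      (∫ r, κ r.1 r.2 ^ 2 ∂(μ.prod μ)) *
        ((if p.1 = q.1 ∧ p.2 = q.2 then 1 else 0) + (if p.1 = q.2 ∧ p.2 = q.1 then 1 else 0)) := by
  obtain ⟨a, b⟩ := p
  obtain ⟨c, d⟩ := q
  simp only at hp hq ⊢
  have c1 : 0 ≤ ∫ x, (∫ y, κ x y ∂μ) ^ 2 ∂μ := integral_nonneg fun x => sq_nonneg _
  have c2 : 0 ≤ ∫ r, κ r.1 r.2 ^ 2 ∂(μ.prod μ) := integral_nonneg fun x => sq_nonneg _
  have hL := memLp_kernel_pi (N := N) μ hκ h0 hC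
  have hcov : ∀ a b c d : Fin N,
      cov[fun x => κ (x a) (x b), fun x => κ (x c) (x d); Measure.pi fun _ : Fin N => μ] ≤
      ∫ x, κ (x a) (x b) * κ (x c) (x d) ∂(Measure.pi fun _ : Fin N => μ) := fun a b c d =>
    covariance_le_integral_mul (hL a b) (hL c d) (fun _ => h0 _ _) (fun _ => h0 _ _)
  have hsq : ∀ a b : Fin N, a ≠ b →
      ∫ x, κ (x a) (x b) * κ (x a) (x b) ∂(Measure.pi fun _ : Fin N => μ) =
        ∫ r, κ r.1 r.2 ^ 2 ∂(μ.prod μ) := by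
    intro a b hab
    rw [← integral_kernel_pair_pi (κ := fun x y => κ x y ^ 2) μ (hκ.pow_const 2) hab]
    simp only [sq]
  have h3 := fun {k l m : Fin N} => integral_kernel_mul_kernel_pi (k := k) (l := l) (m := m) μ hκ h0 hC
  by_cases hac : a = c
  · subst hac
    by_cases hbd : b = d
    · subst hbd
      refine (hcov _ _ _ _).trans ?_
      rw [hsq _ _ hp]
      simp [hp, hp.symm]; linarith
    · refine (hcov _ _ _ _).trans ?_
      rw [h3 hp hq hbd]
      simp [hq, hp.symm, hbd]
  · by_cases had : a = d
    · subst had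
      by_cases hbc : b = c
      · subst hbc
        refine (hcov _ _ _ _).trans ?_
        have e : ∀ x : Fin N → X, κ (x b) (x a) = κ (x a) (x b) := fun x => hsymm _ _
        simp only [e, hsq _ _ hp]
        simp [hp, hp.symm]; linarith
      · refine (hcov _ _ _ _).trans ?_
        have e : ∀ x : Fin N → X, κ (x c) (x a) = κ (x a) (x c) := fun x => hsymm _ _
        simp only [e, h3 hp hq.symm hbc]
        simp [hac, hp.symm, hbc]
    · by_cases hbc : b = c
      · subst hbc
        refine (hcov _ _ _ _).trans ?_
        have e : ∀ x : Fin N → X, κ (x a) (x b) = κ (x b) (x a) := fun x => hsymm _ _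
        simp only [e, h3 hp.symm hq had]
        simp [hp, had, hq]
      · by_cases hbd : b = d
        · subst hbd
          refine (hcov _ _ _ _).trans ?_
          have e : ∀ x : Fin N → X, κ (x a) (x b) = κ (x b) (x a) := fun x => hsymm _ _
          have e' : ∀ x : Fin N → X, κ (x c) (x b) = κ (x b) (x c) := fun x => hsymm _ _
          simp only [e, e', h3 hp.symm hq.symm hac]
          simp [hp, hac, hbc]
        · have hind := (iIndepFun_eval_pi (N := N) μ).indepFun_prodMk_prodMk (fun i => by fun_prop)
            a b c d hac had hbc hbd
          have := (hind.comp hκ hκ).covariance_eq_zero (hL a b) (hL c d)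
          refine this.le.trans ?_
          positivity

include hκ h0 hC hsymm in
/-- A variance bound for a U-statistic of order two with a nonnegative bounded kernel. -/
theorem variance_sum_offDiag_le :
    Var[fun x => ∑ p ∈ (Finset.univ : Finset (Fin N)).offDiag, κ (x p.1) (x p.2);
        Measure.pi fun _ : Fin N => μ] ≤
      4 * N ^ 3 * (∫ x, (∫ y, κ x y ∂μ) ^ 2 ∂μ) + 2 * N ^ 2 * ∫ r, κ r.1 r.2 ^ 2 ∂(μ.prod μ) := by
  have c1 : 0 ≤ ∫ x, (∫ y, κ x y ∂μ) ^ 2 ∂μ := integral_nonneg fun x => sq_nonneg _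
  have c2 : 0 ≤ ∫ r, κ r.1 r.2 ^ 2 ∂(μ.prod μ) := integral_nonneg fun x => sq_nonneg _
  set A := ∫ x, (∫ y, κ x y ∂μ) ^ 2 ∂μ with hA
  set B := ∫ r, κ r.1 r.2 ^ 2 ∂(μ.prod μ) with hB
  rw [variance_fun_sum' (fun p _ => memLp_kernel_pi μ hκ h0 hC p.1 p.2)]
  let w : Fin N × Fin N → Fin N × Fin N → ℝ := fun p q =>
    A * ((if p.1 = q.1 then 1 else 0) + (if p.1 = q.2 then 1 else 0) +
          (if p.2 = q.1 then 1 else 0) + (if p.2 = q.2 then 1 else 0)) +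
      B * ((if p.1 = q.1 ∧ p.2 = q.2 then 1 else 0) + (if p.1 = q.2 ∧ p.2 = q.1 then 1 else 0))
  have hw : ∀ p q, 0 ≤ w p q := fun p q => by positivity
  calc _ ≤ ∑ p ∈ (Finset.univ : Finset (Fin N)).offDiag,
        ∑ q ∈ (Finset.univ : Finset (Fin N)).offDiag, w p q := by
        refine Finset.sum_le_sum fun p hp => Finset.sum_le_sum fun q hq => ?_
        simp only [Finset.mem_offDiag, Finset.mem_univ, true_and] at hp hq
        exact covariance_kernel_le μ hκ h0 hC hsymm hp hq
    -- Over all pairs the count is exact: each of the four single coincidences leaves N³ choices,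
    -- each of the two double ones N².
    _ ≤ ∑ p, ∑ q, w p q := by
        refine (Finset.sum_le_sum fun p _ => Finset.sum_le_univ_sum_of_nonneg (hw p)).trans ?_
        exact Finset.sum_le_univ_sum_of_nonneg fun p => Finset.sum_nonneg fun q _ => hw p q
    _ = 4 * N ^ 3 * A + 2 * N ^ 2 * B := by
        simp only [w, Finset.sum_add_distrib, ← Finset.mul_sum, Fintype.sum_prod_type, ite_and]
        simp [apply_ite Finset.card]
        ring

end UStatistic

noncomputable section

/-! ### Gram kernels: duality and concentration -/

section Gram

lemma sq_integral_le_integral_sq {Ω : Type*} [MeasurableSpace Ω] {P : Measure Ω}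
    [IsProbabilityMeasure P] {f : Ω → ℝ} (hf : MemLp f 2 P) :
    (∫ x, f x ∂P) ^ 2 ≤ ∫ x, f x ^ 2 ∂P := by
  have := variance_nonneg f P
  rw [variance_eq_sub hf] at this
  simpa using this

lemma norm_integral_sq_le {Ω : Type*} [MeasurableSpace Ω] {P : Measure Ω}
    [IsProbabilityMeasure P] {f : Ω → ℂ} (hf : MemLp f 2 P) :
    ‖∫ x, f x ∂P‖ ^ 2 ≤ ∫ x, ‖f x‖ ^ 2 ∂P :=
  (pow_le_pow_left₀ (norm_nonneg _) (norm_integral_le_integral_norm f) 2).trans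
    (sq_integral_le_integral_sq hf.norm)

variable {X X' Z : Type*} [MeasurableSpace X] [MeasurableSpace X'] [MeasurableSpace Z]

/-- The Gram kernel `K(x, x') = ∫ a(x, z) conj a(x', z) dν(z)` of a complex kernel `a`. -/
def gramKernel (ν : Measure Z) (a : X → Z → ℂ) (x x' : X) : ℂ :=
  ∫ z, a x z * (starRingEnd ℂ) (a x' z) ∂ν

variable {ν : Measure Z} [IsProbabilityMeasure ν] {a : X → Z → ℂ} {b : ℝ}

omit [MeasurableSpace X] in
lemma norm_gramKernel_le (hb : ∀ x z, ‖a x z‖ ≤ b) (x x' : X) :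
    ‖gramKernel ν a x x'‖ ≤ b ^ 2 := by
  refine (norm_integral_le_of_norm_le_const (C := b ^ 2) (ae_of_all _ fun z => ?_)).trans ?_
  · rw [norm_mul, RCLike.norm_conj, sq]
    exact mul_le_mul (hb _ _) (hb _ _) (norm_nonneg _) ((norm_nonneg _).trans (hb x z))
  · simp

omit [IsProbabilityMeasure ν] [MeasurableSpace X] in
lemma norm_gramKernel_comm (x x' : X) :
    ‖gramKernel ν a x x'‖ = ‖gramKernel ν a x' x‖ := by
  rw [← RCLike.norm_conj (gramKernel ν a x x'), gramKernel, gramKernel, ← integral_conj]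
  simp [mul_comm]

lemma measurable_gramKernel (ha : Measurable (Function.uncurry a)) :
    Measurable (fun p : X × X => gramKernel ν a p.1 p.2) := by
  refine (StronglyMeasurable.integral_prod_right
    (f := fun (p : X × X) (z : Z) => a p.1 z * (starRingEnd ℂ) (a p.2 z)) ?_).measurable
  refine Measurable.stronglyMeasurable ?_
  exact (ha.comp (f := fun q : (X × X) × Z => (q.1.1, q.2)) (by fun_prop)).mul
    (Complex.continuous_conj.measurable.comp
      (ha.comp (f := fun q : (X × X) × Z => (q.1.2, q.2)) (by fun_prop)))

/-- The Hilbert-Schmidt duality `‖A B*‖² = ⟨A* A, B* B⟩`. -/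
lemma integral_norm_sq_eq_integral_gramKernel {μ : Measure X} {μ' : Measure X'}
    [IsProbabilityMeasure μ] [IsProbabilityMeasure μ'] {A : X → Z → ℂ} {B : X' → Z → ℂ}
    (hA : Measurable (Function.uncurry A)) (hB : Measurable (Function.uncurry B))
    (hbA : ∀ x z, ‖A x z‖ ≤ b) (hbB : ∀ x z, ‖B x z‖ ≤ b) :
    ((∫ p, ‖∫ z, A p.1 z * (starRingEnd ℂ) (B p.2 z) ∂ν‖ ^ 2 ∂(μ.prod μ') : ℝ) : ℂ) =
      ∫ q, gramKernel μ (fun z x => A x z) q.1 q.2 *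
        (starRingEnd ℂ) (gramKernel μ' (fun z x => B x z) q.1 q.2) ∂(ν.prod ν) := by
  have hconj : Measurable (starRingEnd ℂ) := Complex.continuous_conj.measurable
  have h1 : ∀ p : X × X', ((‖∫ z, A p.1 z * (starRingEnd ℂ) (B p.2 z) ∂ν‖ ^ 2 : ℝ) : ℂ) =
      ∫ q : Z × Z, (A p.1 q.1 * (starRingEnd ℂ) (B p.2 q.1)) *
        (starRingEnd ℂ) (A p.1 q.2 * (starRingEnd ℂ) (B p.2 q.2)) ∂(ν.prod ν) := by
    intro p
    rw [integral_prod_mul (fun z => A p.1 z * (starRingEnd ℂ) (B p.2 z))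
      (fun z => (starRingEnd ℂ) (A p.1 z * (starRingEnd ℂ) (B p.2 z))), integral_conj,
      Complex.mul_conj, Complex.normSq_eq_norm_sq]
  have h2 : ∀ q : Z × Z, gramKernel μ (fun z x => A x z) q.1 q.2 *
        (starRingEnd ℂ) (gramKernel μ' (fun z x => B x z) q.1 q.2) =
      ∫ p : X × X', (A p.1 q.1 * (starRingEnd ℂ) (A p.1 q.2)) *
        (starRingEnd ℂ) (B p.2 q.1 * (starRingEnd ℂ) (B p.2 q.2)) ∂(μ.prod μ') := by
    intro q
    rw [integral_prod_mul (fun x => A x q.1 * (starRingEnd ℂ) (A x q.2))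
      (fun x => (starRingEnd ℂ) (B x q.1 * (starRingEnd ℂ) (B x q.2))), integral_conj]
    rfl
  rw [← integral_complex_ofReal]
  simp_rw [h1, h2]
  -- Both sides are now iterated integrals of the same product of four kernel values.
  rw [integral_integral_swap]
  · refine integral_congr_ae (ae_of_all _ fun q => integral_congr_ae (ae_of_all _ fun p => ?_))
    simp only [map_mul, Complex.conj_conj]
    ring
  · refine Integrable.of_bound (C := (b * b) * (b * b)) (Measurable.aestronglyMeasurable ?_)
      (ae_of_all _ fun r => ?_)
    · have e1 := hA.comp (f := fun r : (X × X') × (Z × Z) => (r.1.1, r.2.1)) (by fun_prop)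
      have e2 := hB.comp (f := fun r : (X × X') × (Z × Z) => (r.1.2, r.2.1)) (by fun_prop)
      have e3 := hA.comp (f := fun r : (X × X') × (Z × Z) => (r.1.1, r.2.2)) (by fun_prop)
      have e4 := hB.comp (f := fun r : (X × X') × (Z × Z) => (r.1.2, r.2.2)) (by fun_prop)
      exact (e1.mul (hconj.comp e2)).mul (hconj.comp (e3.mul (hconj.comp e4)))
    · have b0 : 0 ≤ b := (norm_nonneg _).trans (hbA r.1.1 r.2.1)
      simp only [Function.uncurry, norm_mul, RCLike.norm_conj]
      gcongr <;> first | exact hbA _ _ | exact hbB _ _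

lemma measurable_uncurry_flip {W : Type*} [MeasurableSpace W] {f : X → Z → W}
    (hf : Measurable (Function.uncurry f)) : Measurable (Function.uncurry fun z x => f x z) :=
  hf.comp measurable_swap

lemma gramKernel_duality {μ : Measure X} [IsProbabilityMeasure μ]
    (ha : Measurable (Function.uncurry a)) (hb : ∀ x z, ‖a x z‖ ≤ b) :
    ∫ p, ‖gramKernel ν a p.1 p.2‖ ^ 2 ∂(μ.prod μ) =
      ∫ q, ‖gramKernel μ (fun z x => a x z) q.1 q.2‖ ^ 2 ∂(ν.prod ν) := by
  have := integral_norm_sq_eq_integral_gramKernel (ν := ν) (μ := μ) (μ' := μ) ha ha hb hb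
  simp_rw [Complex.mul_conj, Complex.normSq_eq_norm_sq, integral_complex_ofReal] at this
  exact_mod_cast this

lemma memLp_gramKernel {μ : Measure X} [IsProbabilityMeasure μ]
    (ha : Measurable (Function.uncurry a)) (hb : ∀ x z, ‖a x z‖ ≤ b) (p : ℝ≥0∞) :
    MemLp (fun q : X × X => gramKernel ν a q.1 q.2) p (μ.prod μ) :=
  MemLp.of_bound (measurable_gramKernel ha).aestronglyMeasurable (b ^ 2)
    (ae_of_all _ fun _ => norm_gramKernel_le hb _ _)

/-- Duality with a Dirac mass on one side bounds one row by the mean modulus of the dual Gram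
kernel, hence by the root of its mean square, which duality identifies with the mean square of the
original kernel. This gain over the trivial bound `b ^ 4` keeps the variance small when the mean is
small. -/
lemma integral_norm_sq_gramKernel_le {μ : Measure X} [IsProbabilityMeasure μ]
    (ha : Measurable (Function.uncurry a)) (hb : ∀ x z, ‖a x z‖ ≤ b) (x : X) :
    ∫ x', ‖gramKernel ν a x x'‖ ^ 2 ∂μ ≤
      b ^ 2 * √(∫ p, ‖gramKernel ν a p.1 p.2‖ ^ 2 ∂(μ.prod μ)) := by
  have ha' : Measurable (Function.uncurry fun (z : Z) (x : X) => a x z) :=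
    ha.comp measurable_swap
  have hdx : Measurable (Function.uncurry fun (_ : Unit) z => a x z) :=
    ha.comp (f := fun q : Unit × Z => (x, q.2)) (by fun_prop)
  have h := integral_norm_sq_eq_integral_gramKernel (ν := ν) (μ := Measure.dirac ())
    (μ' := μ) hdx ha (fun _ => hb x) hb
  have e : ∫ x', ‖gramKernel ν a x x'‖ ^ 2 ∂μ =
      ∫ p : Unit × X, ‖∫ z, a x z * (starRingEnd ℂ) (a p.2 z) ∂ν‖ ^ 2
        ∂((Measure.dirac ()).prod μ) := by
    rw [Measure.dirac_prod, integral_map (by fun_prop)]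
    · rfl
    · refine Measurable.aestronglyMeasurable ?_
      exact ((measurable_gramKernel (ν := ν) ha).comp
        (f := fun q : Unit × X => (x, q.2)) (by fun_prop)).norm.pow_const 2
  have hK := memLp_gramKernel (ν := μ) (μ := ν) ha' (fun z x => hb x z)
  rw [gramKernel_duality ha hb]
  have h3 : ∫ x', ‖gramKernel ν a x x'‖ ^ 2 ∂μ ≤
      b ^ 2 * ∫ q, ‖gramKernel μ (fun z x => a x z) q.1 q.2‖ ∂(ν.prod ν) := by
    rw [e, ← Complex.norm_of_nonneg (integral_nonneg fun _ => sq_nonneg _), h,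
      ← integral_const_mul]
    refine norm_integral_le_of_norm_le (((hK 1).integrable le_rfl).norm.const_mul _)
      (ae_of_all _ fun q => ?_)
    rw [norm_mul, RCLike.norm_conj]
    gcongr
    exact norm_gramKernel_le (fun z _ => hb x z) _ _
  refine h3.trans (mul_le_mul_of_nonneg_left ?_ (sq_nonneg _))
  exact Real.le_sqrt_of_sq_le (sq_integral_le_integral_sq (hK 2).norm)

/-- Concentration of the squared Frobenius norm of the Gram matrix of independent samples. -/
theorem gramKernel_concentration {μ : Measure X} [IsProbabilityMeasure μ]
    (ha : Measurable (Function.uncurry a)) (hb : ∀ x z, ‖a x z‖ ≤ b) {N : ℕ} (hN : 0 < N)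
    {τ : ℝ} (hτN : 1 / (N : ℝ) ≤ τ)
    (hm : ∫ p, ‖gramKernel ν a p.1 p.2‖ ^ 2 ∂(μ.prod μ) ≤ τ) :
    (Measure.pi fun _ : Fin N => μ)
      {x | (2 + b ^ 4) * N ^ 2 * τ < ∑ k, ∑ l, ‖gramKernel ν a (x k) (x l)‖ ^ 2} ≤
      ENNReal.ofReal ((4 * b ^ 2 + 2 * b ^ 4) / √N) := by
  set κ : X → X → ℝ := fun x x' => ‖gramKernel ν a x x'‖ ^ 2 with hκdef
  have hκ : Measurable (Function.uncurry κ) := (measurable_gramKernel ha).norm.pow_const 2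
  have h0 : ∀ x y, 0 ≤ κ x y := fun x y => sq_nonneg _
  have hC : ∀ x y, κ x y ≤ b ^ 4 := fun x y => by
    have := pow_le_pow_left₀ (norm_nonneg _) (norm_gramKernel_le (ν := ν) hb x y) 2
    exact this.trans_eq (by ring)
  have hsymm : ∀ x y, κ x y = κ y x := fun x y => by
    simp only [hκdef, norm_gramKernel_comm x y]
  set m := ∫ p, κ p.1 p.2 ∂(μ.prod μ) with hmdef
  have hm0 : 0 ≤ m := integral_nonneg fun _ => h0 _ _
  have hNpos : (0 : ℝ) < N := by exact_mod_cast hN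
  have hτ : 0 < τ := lt_of_lt_of_le (by positivity) hτN
  have hκi : Integrable (fun p : X × X => κ p.1 p.2) (μ.prod μ) :=
    Integrable.of_bound hκ.aestronglyMeasurable (b ^ 4) (ae_of_all _ fun p => by
      rw [Real.norm_of_nonneg (h0 _ _)]; exact hC _ _)
  have hbar : ∀ x, ∫ y, κ x y ∂μ ≤ b ^ 2 * √m := integral_norm_sq_gramKernel_le ha hb
  have hbar0 : ∀ x, 0 ≤ ∫ y, κ x y ∂μ := fun x => integral_nonneg fun _ => h0 _ _
  have c1 : ∫ x, (∫ y, κ x y ∂μ) ^ 2 ∂μ ≤ b ^ 2 * √m * m := by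
    have hm' : m = ∫ x, ∫ y, κ x y ∂μ ∂μ := integral_prod _ hκi
    rw [show b ^ 2 * √m * m = b ^ 2 * √m * ∫ x, ∫ y, κ x y ∂μ ∂μ by rw [← hm'],
      ← integral_const_mul]
    refine integral_mono_of_nonneg (ae_of_all _ fun x => sq_nonneg _)
      (hκi.integral_prod_left.const_mul _) (ae_of_all _ fun x => ?_)
    simp only [sq (∫ y, κ x y ∂μ)]
    exact mul_le_mul_of_nonneg_right (hbar x) (hbar0 x)
  have c2 : ∫ r, κ r.1 r.2 ^ 2 ∂(μ.prod μ) ≤ b ^ 4 * m := by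
    rw [hmdef, ← integral_const_mul]
    refine integral_mono_of_nonneg (ae_of_all _ fun x => sq_nonneg _)
      (hκi.const_mul _) (ae_of_all _ fun x => ?_)
    simp only [sq (κ x.1 x.2)]
    exact mul_le_mul_of_nonneg_right (hC _ _) (h0 _ _)
  set U : (Fin N → X) → ℝ := fun x =>
    ∑ p ∈ (Finset.univ : Finset (Fin N)).offDiag, κ (x p.1) (x p.2) with hU
  set P := Measure.pi fun _ : Fin N => μ with hP
  have hkl := memLp_kernel_pi (N := N) μ hκ h0 hC
  have hUL : MemLp U 2 P := memLp_finsetSum _ fun p _ => hkl p.1 p.2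
  have hmean : ∫ x, U x ∂P ≤ N ^ 2 * τ := by
    rw [hU, integral_finsetSum _ fun p _ => (hkl p.1 p.2).integrable one_le_two]
    calc _ ≤ ∑ p ∈ (Finset.univ : Finset (Fin N)).offDiag, τ := by
          refine Finset.sum_le_sum fun p hp => ?_
          rw [integral_kernel_pair_pi μ hκ (Finset.mem_offDiag.1 hp).2.2]
          exact hm
      _ ≤ N ^ 2 * τ := by
          rw [Finset.sum_const, nsmul_eq_mul]
          refine mul_le_mul_of_nonneg_right ?_ hτ.le
          rw [Finset.offDiag_card, Finset.card_univ, Fintype.card_fin]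
          exact_mod_cast (Nat.sub_le _ _).trans_eq (sq N).symm
  have hvar : Var[U; P] ≤ 4 * N ^ 3 * (b ^ 2 * √τ * τ) + 2 * N ^ 2 * (b ^ 4 * τ) := by
    refine (variance_sum_offDiag_le μ hκ h0 hC hsymm).trans ?_
    gcongr
    · refine c1.trans ?_
      gcongr
    · refine c2.trans ?_
      gcongr
  -- The diagonal is at most b⁴N ≤ b⁴N²τ and the mean of `U` at most N²τ, so crossing the threshold
  -- forces `U` to deviate by N²τ.
  have hsub : {x : Fin N → X | (2 + b ^ 4) * N ^ 2 * τ < ∑ k, ∑ l, κ (x k) (x l)} ⊆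
      {x | N ^ 2 * τ ≤ |U x - ∫ x, U x ∂P|} := by
    intro x hx
    simp only [Set.mem_ofPred_eq] at hx ⊢
    have hsplit : ∑ k, ∑ l, κ (x k) (x l) = ∑ k, κ (x k) (x k) + U x := by
      rw [← Finset.sum_product', ← Finset.diag_union_offDiag,
        Finset.sum_union (Finset.disjoint_diag_offDiag _), Finset.sum_diag]
    have hdiag : ∑ k, κ (x k) (x k) ≤ b ^ 4 * (N ^ 2 * τ) := by
      calc _ ≤ ∑ k : Fin N, b ^ 4 := Finset.sum_le_sum fun k _ => hC _ _
        _ = b ^ 4 * N := by simp [mul_comm]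
        _ ≤ b ^ 4 * (N ^ 2 * τ) := by
          refine mul_le_mul_of_nonneg_left ?_ (by positivity)
          rw [div_le_iff₀ hNpos] at hτN
          nlinarith
    refine le_trans ?_ (le_abs_self _)
    linarith
  refine (measure_mono hsub).trans ?_
  refine (meas_ge_le_variance_div_sq hUL (by positivity)).trans (ENNReal.ofReal_le_ofReal ?_)
  rw [div_le_iff₀ (by positivity)]
  refine hvar.trans ?_
  -- With r = √N and s = √τ, the hypothesis 1/N ≤ τ reads 1 ≤ rs. The relative variance is at most
  -- 4b²/(r²s) + 2b⁴/(r⁴s²), hence at most (4b² + 2b⁴)/r.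
  set r := √(N : ℝ) with hr
  have hr0 : 0 < r := Real.sqrt_pos.2 hNpos
  have hr2 : (N : ℝ) = r ^ 2 := (Real.sq_sqrt hNpos.le).symm
  set s := √τ with hs
  have hs0 : 0 < s := Real.sqrt_pos.2 hτ
  have hs2 : τ = s ^ 2 := (Real.sq_sqrt hτ.le).symm
  have hrs : 1 ≤ r * s := by
    rw [hr, hs, ← Real.sqrt_mul hNpos.le, Real.one_le_sqrt]
    rwa [div_le_iff₀' hNpos] at hτN
  have hr1 : 1 ≤ r := by rw [hr, Real.one_le_sqrt]; exact_mod_cast hN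
  rw [hr2, hs2, div_mul_eq_mul_div, le_div_iff₀ hr0]
  have e1 : r ^ 7 * s ^ 3 * 1 ≤ r ^ 7 * s ^ 3 * (r * s) := by gcongr
  have e2 : r ^ 5 * s ^ 2 * (1 * 1 * 1) ≤ r ^ 5 * s ^ 2 * (r * (r * s) * (r * s)) := by gcongr
  have hb2 : 0 ≤ b ^ 2 := by positivity
  have hb4 : 0 ≤ b ^ 4 := by positivity
  nlinarith [mul_le_mul_of_nonneg_left e1 hb2, mul_le_mul_of_nonneg_left e2 hb4]

end Gram
end

noncomputable section

/-! ### Non-stationary phase for path differences -/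

section Oscillatory

/-- Integration by parts for an oscillatory integral with amplitude `θ ψ'` and phase `ψ`. -/
lemma norm_integral_mul_exp_le {θ θ' ψ ψ' : ℝ → ℝ} (hθ : ∀ x, HasDerivAt θ (θ' x) x)
    (hψ : ∀ x, HasDerivAt ψ (ψ' x) x) (hθc : Continuous θ') (hψc : Continuous ψ') {B B' : ℝ}
    (hB : ∀ x ∈ Set.Icc (0 : ℝ) 1, |θ x| ≤ B) (hB' : ∀ x ∈ Set.Icc (0 : ℝ) 1, |θ' x| ≤ B') :
    ‖∫ x in (0 : ℝ)..1, ((θ x * ψ' x : ℝ) : ℂ) * Complex.exp (Complex.I * (ψ x : ℂ))‖ ≤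
      2 * B + B' := by
  have hθC : Continuous θ := continuous_iff_continuousAt.2 fun x => (hθ x).continuousAt
  have hψC : Continuous ψ := continuous_iff_continuousAt.2 fun x => (hψ x).continuousAt
  set E : ℝ → ℂ := fun x => Complex.exp (Complex.I * (ψ x : ℂ)) with hE
  have hEn : ∀ x, ‖E x‖ = 1 := fun x => by
    simp only [hE]; rw [mul_comm]; exact Complex.norm_exp_ofReal_mul_I _
  have hEC : Continuous E := by fun_prop
  have hEd : ∀ x, HasDerivAt E (E x * (Complex.I * (ψ' x : ℂ))) x := fun x =>
    (((hψ x).ofReal_comp).const_mul Complex.I).cexp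
  have hθd : ∀ x, HasDerivAt (fun x => (θ x : ℂ)) (θ' x : ℂ) x := fun x => (hθ x).ofReal_comp
  have hparts := intervalIntegral.integral_mul_deriv_eq_deriv_mul (a := 0) (b := 1)
    (fun x _ => hθd x) (fun x _ => hEd x)
    (Continuous.intervalIntegrable (by fun_prop) _ _)
    (Continuous.intervalIntegrable (by fun_prop) _ _)
  have h1 : ∫ x in (0 : ℝ)..1, ((θ x * ψ' x : ℝ) : ℂ) * E x =
      -Complex.I * ∫ x in (0 : ℝ)..1, (θ x : ℂ) * (E x * (Complex.I * (ψ' x : ℂ))) := by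
    rw [← intervalIntegral.integral_const_mul]
    refine intervalIntegral.integral_congr fun x _ => ?_
    push_cast
    linear_combination ((θ x : ℂ) * ψ' x * E x) * Complex.I_sq
  have h0m : (0 : ℝ) ∈ Set.Icc (0 : ℝ) 1 := by simp
  have h1m : (1 : ℝ) ∈ Set.Icc (0 : ℝ) 1 := by simp
  rw [h1, norm_mul, norm_neg, Complex.norm_I, one_mul, hparts]
  have h2 : ‖∫ x in (0 : ℝ)..1, (θ' x : ℂ) * E x‖ ≤ B' := by
    have := intervalIntegral.norm_integral_le_of_norm_le_const (a := 0) (b := 1)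
      (f := fun x => (θ' x : ℂ) * E x) (C := B') fun x hx => ?_
    · simpa using this
    · rw [Set.uIoc_of_le zero_le_one] at hx
      rw [norm_mul, hEn, mul_one, Complex.norm_real]
      exact hB' x ⟨hx.1.le, hx.2⟩
  have h3 : ‖(θ 1 : ℂ) * E 1‖ ≤ B := by
    rw [norm_mul, hEn, mul_one, Complex.norm_real]; exact hB 1 h1m
  have h4 : ‖(θ 0 : ℂ) * E 0‖ ≤ B := by
    rw [norm_mul, hEn, mul_one, Complex.norm_real]; exact hB 0 h0m
  calc _ ≤ ‖(θ 1 : ℂ) * E 1‖ + ‖(θ 0 : ℂ) * E 0‖ + ‖∫ x in (0 : ℝ)..1, (θ' x : ℂ) * E x‖ :=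
        (norm_sub_le _ _).trans (add_le_add_left (norm_sub_le _ _) _)
    _ ≤ 2 * B + B' := by linarith

/-- Euclidean distance to the origin of a point with coordinates `ℓ` and `w`. -/
def hypot (l w : ℝ) : ℝ := √(l ^ 2 + w ^ 2)

variable {l : ℝ}

lemma hypot_sq (l w : ℝ) : hypot l w ^ 2 = l ^ 2 + w ^ 2 := Real.sq_sqrt (by positivity)

lemma le_hypot (l w : ℝ) : l ≤ hypot l w :=
  Real.le_sqrt_of_sq_le (by nlinarith [sq_nonneg w])

lemma hypot_pos (hl : 0 < l) (w : ℝ) : 0 < hypot l w := hl.trans_le (le_hypot l w)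

lemma abs_div_hypot_le_one (w : ℝ) : |w / hypot l w| ≤ 1 := by
  have h0 : 0 ≤ hypot l w := Real.sqrt_nonneg _
  rw [abs_div, abs_of_nonneg h0]
  refine div_le_one_of_le₀ ?_ (Real.sqrt_nonneg _)
  exact Real.abs_le_sqrt (by nlinarith [sq_nonneg l])

lemma continuous_hypot : Continuous (hypot l) := by unfold hypot; fun_prop

lemma hasDerivAt_hypot (hl : 0 < l) (w : ℝ) : HasDerivAt (hypot l) (w / hypot l w) w := by
  have h : HasDerivAt (fun w : ℝ => l ^ 2 + w ^ 2) (2 * w) w := by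
    simpa using (hasDerivAt_pow 2 w).const_add (l ^ 2)
  have := h.sqrt (by positivity)
  refine this.congr_deriv ?_
  rw [hypot, mul_div_mul_left _ _ two_ne_zero]

lemma hasDerivAt_div_hypot (hl : 0 < l) (w : ℝ) :
    HasDerivAt (fun w => w / hypot l w) (l ^ 2 / hypot l w ^ 3) w := by
  have hr := hypot_pos hl w
  refine ((hasDerivAt_id w).div (hasDerivAt_hypot hl w) hr.ne').congr_deriv ?_
  have := hypot_sq l w
  simp only [id]
  field_simp
  linear_combination this

lemma hasDerivAt_sq_div_hypot_cube (hl : 0 < l) (w : ℝ) :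
    HasDerivAt (fun w => l ^ 2 / hypot l w ^ 3) (-(3 * l ^ 2 * w / hypot l w ^ 5)) w := by
  have hr := hypot_pos hl w
  refine ((hasDerivAt_const w (l ^ 2)).div ((hasDerivAt_hypot hl w).pow 3)
    (by simp; exact hr.ne')).congr_deriv ?_
  field_simp
  simp
  ring

lemma hypot_le_of_abs_le (hl : 1 ≤ l) {w : ℝ} (hw : |w| ≤ 1) : hypot l w ^ 3 ≤ 3 * l ^ 3 := by
  have h2 : hypot l w ^ 2 ≤ 2 * l ^ 2 := by
    rw [hypot_sq]
    nlinarith [sq_abs w, abs_nonneg w]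
  have hr := hypot_pos (by linarith : 0 < l) w
  have h3 : hypot l w ≤ 3 / 2 * l := by
    refine Real.sqrt_le_iff.2 ⟨by linarith, ?_⟩
    rw [← hypot_sq]
    nlinarith
  calc hypot l w ^ 3 = hypot l w ^ 2 * hypot l w := by ring
    _ ≤ 2 * l ^ 2 * (3 / 2 * l) := by gcongr
    _ = 3 * l ^ 3 := by ring

lemma one_div_le_deriv_div_hypot (hl : 1 ≤ l) {w : ℝ} (hw : |w| ≤ 1) :
    1 / (3 * l) ≤ l ^ 2 / hypot l w ^ 3 := by
  have hr := hypot_pos (by linarith : 0 < l) w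
  rw [div_le_div_iff₀ (by positivity) (by positivity), one_mul]
  linarith [hypot_le_of_abs_le hl hw]

lemma abs_deriv_sq_div_hypot_cube_le (hl : 1 ≤ l) {w : ℝ} (hw : |w| ≤ 1) :
    |-(3 * l ^ 2 * w / hypot l w ^ 5)| ≤ 3 / l := by
  have hl0 : 0 < l := by linarith
  have hr := hypot_pos hl0 w
  rw [abs_neg, abs_div, abs_mul, abs_of_pos (by positivity : 0 < 3 * l ^ 2),
    abs_of_pos (by positivity : 0 < hypot l w ^ 5), div_le_div_iff₀ (by positivity) hl0]
  have h5 : l ^ 5 ≤ hypot l w ^ 5 := pow_le_pow_left₀ hl0.le (le_hypot l w) 5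
  have h3 : l ^ 3 ≤ l ^ 5 := pow_le_pow_right₀ hl (by norm_num)
  calc 3 * l ^ 2 * |w| * l ≤ 3 * l ^ 2 * 1 * l := by gcongr
    _ = 3 * l ^ 3 := by ring
    _ ≤ _ := by linarith

/-- `w / hypot l w` is the derivative of the distance, and its own slope is of order 1/l when |w| ≤
1 ≤ l. Thus the phase derivatives belonging to two transmitters stay apart. -/
lemma div_hypot_sub_ge (hl : 1 ≤ l) {w w' : ℝ} (hw : |w| ≤ 1) (hw' : |w'| ≤ 1) :
    |w' - w| / (3 * l) ≤ |w' / hypot l w' - w / hypot l w| := by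
  have hl0 : 0 < l := by linarith
  wlog h : w ≤ w' generalizing w w'
  · rw [abs_sub_comm, abs_sub_comm (w' / _)]
    exact this hw' hw (le_of_not_ge h)
  have hcont : ContinuousOn (fun w => w / hypot l w) (Set.Icc (-1) 1) := fun x _ =>
    (hasDerivAt_div_hypot hl0 x).continuousAt.continuousWithinAt
  have := (convex_Icc (-1 : ℝ) 1).mul_sub_le_image_sub_of_le_deriv (C := 1 / (3 * l)) hcont
    (fun x _ => (hasDerivAt_div_hypot hl0 x).differentiableAt.differentiableWithinAt)
    (fun x hx => by
      rw [(hasDerivAt_div_hypot hl0 x).deriv]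
      rw [interior_Icc] at hx
      exact one_div_le_deriv_div_hypot hl (abs_le.2 ⟨hx.1.le, hx.2.le⟩))
    w (abs_le.1 hw) w' (abs_le.1 hw') h
  refine le_trans ?_ (this.trans (le_abs_self _))
  rw [abs_of_nonneg (sub_nonneg.2 h)]
  exact le_of_eq (by ring)

lemma sq_div_hypot_cube_sub_le (hl : 1 ≤ l) {w w' : ℝ} (hw : |w| ≤ 1) (hw' : |w'| ≤ 1) :
    |l ^ 2 / hypot l w' ^ 3 - l ^ 2 / hypot l w ^ 3| ≤ 3 / l * |w' - w| := by
  have hl0 : 0 < l := by linarith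
  exact (convex_Icc (-1 : ℝ) 1).norm_image_sub_le_of_norm_hasDerivWithin_le
    (fun x _ => (hasDerivAt_sq_div_hypot_cube hl0 x).hasDerivWithinAt)
    (fun x hx => abs_deriv_sq_div_hypot_cube_le hl (abs_le.2 hx)) (abs_le.1 hw) (abs_le.1 hw')

/-- The derivative in `v` of the path difference never vanishes and has size at least |t - t'|/(3l),
so one integration by parts, with the amplitude divided by the phase derivative, is enough. -/
lemma norm_integral_hypot_phase_le (hl : 1 ≤ l) {K : ℝ} (hK : 0 < K) {t t' : ℝ}
    (ht : t ∈ Set.Icc (0 : ℝ) 1) (ht' : t' ∈ Set.Icc (0 : ℝ) 1) (hne : t ≠ t') :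
    ‖∫ v in (0 : ℝ)..1, ((1 / (hypot l (v - t) * hypot l (v - t')) : ℝ) : ℂ) *
      Complex.exp (Complex.I * ((K * (hypot l (v - t') - hypot l (v - t)) : ℝ) : ℂ))‖ ≤
      39 / (l * K * |t - t'|) := by
  have hl0 : 0 < l := by linarith
  have hτ : 0 < |t - t'| := abs_pos.2 (sub_ne_zero.2 hne)
  set τ := |t - t'| with hτdef
  set F : ℝ → ℝ := fun w => w / hypot l w with hF
  set F' : ℝ → ℝ := fun w => l ^ 2 / hypot l w ^ 3 with hF'
  have hFd : ∀ w, HasDerivAt F (F' w) w := hasDerivAt_div_hypot hl0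
  have hFmono : StrictMono F := strictMono_of_deriv_pos fun w => by
    have := hypot_pos hl0 w
    rw [(hFd w).deriv]; positivity
  have hpos := hypot_pos hl0
  have hhc : Continuous (hypot l) := continuous_hypot
  have hFc : Continuous F := continuous_iff_continuousAt.2 fun x => (hFd x).continuousAt
  have hF'c : Continuous F' := continuous_const.div (by fun_prop) fun x => (pow_pos (hpos x) 3).ne'
  set α : ℝ → ℝ := fun v => 1 / (hypot l (v - t) * hypot l (v - t')) with hα
  set α' : ℝ → ℝ := fun v => -(F (v - t) * hypot l (v - t') + hypot l (v - t) * F (v - t')) /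
    (hypot l (v - t) * hypot l (v - t')) ^ 2 with hα'
  set ψ : ℝ → ℝ := fun v => K * (hypot l (v - t') - hypot l (v - t)) with hψ
  set ψ' : ℝ → ℝ := fun v => K * (F (v - t') - F (v - t)) with hψ'
  set ψ'' : ℝ → ℝ := fun v => K * (F' (v - t') - F' (v - t)) with hψ''
  have hψ0 : ∀ v, ψ' v ≠ 0 := fun v =>
    mul_ne_zero hK.ne' (sub_ne_zero.2 fun h => hne (by have := hFmono.injective h; linarith))
  have hαd : ∀ v, HasDerivAt α (α' v) v := fun v => by
    have h1 := (hasDerivAt_hypot hl0 (v - t)).comp_sub_const v t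
    have h2 := (hasDerivAt_hypot hl0 (v - t')).comp_sub_const v t'
    exact ((hasDerivAt_const v (1 : ℝ)).div (h1.mul h2)
      (mul_pos (hpos _) (hpos _)).ne').congr_deriv (by simp [hα', hF])
  have hψd : ∀ v, HasDerivAt ψ (ψ' v) v := fun v =>
    (((hasDerivAt_hypot hl0 (v - t')).comp_sub_const v t').sub
      ((hasDerivAt_hypot hl0 (v - t)).comp_sub_const v t)).const_mul K
  have hψ'd : ∀ v, HasDerivAt ψ' (ψ'' v) v := fun v =>
    (((hFd (v - t')).comp_sub_const v t').sub ((hFd (v - t)).comp_sub_const v t)).const_mul K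
  have hθd : ∀ v, HasDerivAt (fun v => α v / ψ' v)
      ((α' v * ψ' v - α v * ψ'' v) / ψ' v ^ 2) v := fun v => (hαd v).div (hψ'd v) (hψ0 v)
  have hαc : Continuous α := continuous_iff_continuousAt.2 fun x => (hαd x).continuousAt
  have hψ'c : Continuous ψ' := continuous_iff_continuousAt.2 fun x => (hψ'd x).continuousAt
  have hα'c : Continuous α' := by
    refine Continuous.div (by fun_prop) (by fun_prop) fun v => ?_
    exact (pow_pos (mul_pos (hpos _) (hpos _)) 2).ne'
  have hθ'c : Continuous fun v => (α' v * ψ' v - α v * ψ'' v) / ψ' v ^ 2 :=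
    Continuous.div (by fun_prop) (by fun_prop) fun v => pow_ne_zero 2 (hψ0 v)
  have habs : ∀ v ∈ Set.Icc (0 : ℝ) 1, |v - t| ≤ 1 ∧ |v - t'| ≤ 1 := fun v hv =>
    ⟨abs_le.2 ⟨by linarith [hv.1, ht.2], by linarith [hv.2, ht.1]⟩,
      abs_le.2 ⟨by linarith [hv.1, ht'.2], by linarith [hv.2, ht'.1]⟩⟩
  have hdiff : ∀ v, |v - t' - (v - t)| = τ := fun v => by rw [hτdef]; congr 1; ring
  have bψ' : ∀ v ∈ Set.Icc (0 : ℝ) 1, K * τ / (3 * l) ≤ |ψ' v| := fun v hv => by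
    have := div_hypot_sub_ge hl (habs v hv).1 (habs v hv).2
    rw [hdiff] at this
    rw [hψ', abs_mul, abs_of_pos hK, mul_div_assoc]
    exact mul_le_mul_of_nonneg_left this hK.le
  have bψ'' : ∀ v ∈ Set.Icc (0 : ℝ) 1, |ψ'' v| ≤ K * (3 / l * τ) := fun v hv => by
    have := sq_div_hypot_cube_sub_le hl (habs v hv).1 (habs v hv).2
    rw [hdiff] at this
    rw [hψ'', abs_mul, abs_of_pos hK]
    exact mul_le_mul_of_nonneg_left this hK.le
  have bα : ∀ v, |α v| ≤ 1 / l ^ 2 := fun v => by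
    have := mul_le_mul (le_hypot l (v - t)) (le_hypot l (v - t')) hl0.le (hpos _).le
    rw [hα, abs_of_pos (one_div_pos.2 (mul_pos (hpos _) (hpos _)))]
    exact one_div_le_one_div_of_le (by positivity) (by rw [sq]; exact this)
  have bα' : ∀ v, |α' v| ≤ 2 / l ^ 2 := fun v => by
    set x := hypot l (v - t) with hx
    set y := hypot l (v - t') with hy
    have hx0 : 0 < x := hpos _
    have hy0 : 0 < y := hpos _
    have hxl : l ≤ x := le_hypot _ _
    have hyl : l ≤ y := le_hypot _ _
    have f1 : |F (v - t)| ≤ 1 := abs_div_hypot_le_one _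
    have f2 : |F (v - t')| ≤ 1 := abs_div_hypot_le_one _
    have hnum : |-(F (v - t) * y + x * F (v - t'))| ≤ y + x := by
      rw [abs_neg]
      refine (abs_add_le _ _).trans ?_
      rw [abs_mul, abs_mul, abs_of_pos hx0, abs_of_pos hy0]
      nlinarith
    have : α' v = -(F (v - t) * y + x * F (v - t')) / (x * y) ^ 2 := rfl
    rw [this, abs_div, abs_of_pos (by positivity : 0 < (x * y) ^ 2),
      div_le_div_iff₀ (by positivity) (by positivity)]
    have e1 : l ^ 2 ≤ x * y := by rw [sq]; exact mul_le_mul hxl hyl hl0.le hx0.le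
    have e2 : y + x ≤ 2 * (x * y) := by nlinarith
    calc _ ≤ (2 * (x * y)) * (x * y) := mul_le_mul (hnum.trans e2) e1 (by positivity) (by positivity)
      _ = 2 * (x * y) ^ 2 := by ring
  -- In units of 1/(lKτ): α/ψ' is at most 3, α'/ψ' at most 6 and αψ''/ψ'² at most 27. Hence 2·3 + (6
  -- + 27) = 39.
  have key := norm_integral_mul_exp_le hθd hψd hθ'c hψ'c (B := 3 / (l * K * τ))
    (B' := 33 / (l * K * τ)) ?_ ?_
  · have e : ∀ v, α v / ψ' v * ψ' v = α v := fun v => div_mul_cancel₀ _ (hψ0 v)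
    simp only [e] at key
    refine key.trans (le_of_eq ?_)
    field_simp
    norm_num
  · intro v hv
    rw [abs_div]
    calc |α v| / |ψ' v| ≤ (1 / l ^ 2) / (K * τ / (3 * l)) :=
          div_le_div₀ (by positivity) (bα v) (by positivity) (bψ' v hv)
      _ = 3 / (l * K * τ) := by field_simp
  · intro v hv
    have hp : 0 < |ψ' v| := abs_pos.2 (hψ0 v)
    have e : (α' v * ψ' v - α v * ψ'' v) / ψ' v ^ 2 =
        α' v / ψ' v - α v * ψ'' v / ψ' v ^ 2 := by
      have := hψ0 v
      field_simp
    rw [e]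
    refine (abs_sub _ _).trans ?_
    rw [abs_div (α' v) (ψ' v), abs_div (α v * ψ'' v) (ψ' v ^ 2), abs_mul (α v), abs_pow]
    calc _ ≤ (2 / l ^ 2) / (K * τ / (3 * l)) +
          (1 / l ^ 2 * (K * (3 / l * τ))) / (K * τ / (3 * l)) ^ 2 := by
          refine add_le_add (div_le_div₀ (by positivity) (bα' v) (by positivity) (bψ' v hv))
            (div_le_div₀ (by positivity) ?_ (by positivity)
              (pow_le_pow_left₀ (by positivity) (bψ' v hv) 2))
          exact mul_le_mul (bα v) (bψ'' v hv) (abs_nonneg _) (by positivity)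
      _ = 33 / (l * K * τ) := by field_simp; norm_num

end Oscillatory
end

noncomputable section

/-! ### Uniform laws on squares -/

section UnitSquare

/-- The uniform distribution on the unit interval. -/
def unifIcc : Measure ℝ := volume.restrict (Set.Icc 0 1)

instance : IsProbabilityMeasure unifIcc := ⟨by simp [unifIcc]⟩

lemma ae_unifIcc : ∀ᵐ x ∂unifIcc, x ∈ Set.Icc (0 : ℝ) 1 := ae_restrict_mem measurableSet_Icc

lemma integral_unifIcc {E : Type*} [NormedAddCommGroup E] [NormedSpace ℝ E] (f : ℝ → E) :
    ∫ x, f x ∂unifIcc = ∫ x in (0 : ℝ)..1, f x := by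
  rw [unifIcc, integral_Icc_eq_integral_Ioc, intervalIntegral.integral_of_le zero_le_one]

/-- The parametrization of a square by the unit square. -/
def squareParam (a D : ℝ) (p : ℝ × ℝ) : Plane := !₂[a + D * p.1, D * p.2]

lemma continuous_squareParam (a D : ℝ) : Continuous (squareParam a D) := by
  unfold squareParam
  refine (PiLp.continuous_toLp 2 _).comp (continuous_pi fun i => ?_)
  fin_cases i <;> simp <;> fun_prop

lemma map_volume_affine (a : ℝ) {D : ℝ} (hD : 0 < D) :
    (volume : Measure ℝ).map (fun x => a + D * x) = ENNReal.ofReal D⁻¹ • volume := by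
  have : (fun x => a + D * x) = (fun x => a + x) ∘ (fun x => D * x) := rfl
  rw [this, ← Measure.map_map (by fun_prop) (by fun_prop), Real.map_volume_mul_left hD.ne',
    Measure.map_smul, map_add_left_eq_self, abs_of_pos (inv_pos.2 hD)]

lemma map_volume_squareParam (a : ℝ) {D : ℝ} (hD : 0 < D) :
    (volume : Measure (ℝ × ℝ)).map (squareParam a D) =
      (ENNReal.ofReal D⁻¹ * ENNReal.ofReal D⁻¹) • volume := by
  have h : squareParam a D = (WithLp.toLp 2 ∘ MeasurableEquiv.finTwoArrow.symm) ∘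
      Prod.map (fun x => a + D * x) (fun x => 0 + D * x) := by
    funext p
    ext i
    fin_cases i <;> simp [squareParam, MeasurableEquiv.finTwoArrow]
  have hmp : MeasurePreserving (WithLp.toLp 2 ∘ (MeasurableEquiv.finTwoArrow (α := ℝ)).symm)
      volume (volume : Measure Plane) :=
    (PiLp.volume_preserving_toLp (Fin 2)).comp
      ((volume_preserving_finTwoArrow ℝ).symm MeasurableEquiv.finTwoArrow)
  rw [h, ← Measure.map_map hmp.measurable (by fun_prop), Measure.volume_eq_prod,
    ← Measure.map_prod_map _ _ (by fun_prop) (by fun_prop), map_volume_affine _ hD,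
    map_volume_affine _ hD, Measure.prod_smul_left, Measure.prod_smul_right, smul_smul,
    Measure.map_smul, ← Measure.volume_eq_prod, hmp.map_eq]

lemma measurableSet_square (a D : ℝ) : MeasurableSet (square a D) := by
  have : square a D = {p : Plane | a ≤ p 0} ∩ {p | p 0 ≤ a + D} ∩ {p | 0 ≤ p 1} ∩ {p | p 1 ≤ D} := by
    ext p; simp [square, and_assoc]
  rw [this]
  have h0 : Measurable fun p : Plane => p 0 := by fun_prop
  have h1 : Measurable fun p : Plane => p 1 := by fun_prop
  exact (((measurableSet_le measurable_const h0).inter (measurableSet_le h0 measurable_const)).inter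
    (measurableSet_le measurable_const h1)).inter (measurableSet_le h1 measurable_const)

lemma squareParam_preimage (a : ℝ) {D : ℝ} (hD : 0 < D) :
    squareParam a D ⁻¹' square a D = Set.Icc (0 : ℝ) 1 ×ˢ Set.Icc (0 : ℝ) 1 := by
  ext p
  simp only [squareParam, square, Set.mem_preimage, Set.mem_ofPred_eq, Set.mem_prod, Set.mem_Icc]
  simp only [Matrix.cons_val_zero, Matrix.cons_val_one]
  constructor
  · rintro ⟨h1, h2, h3, h4⟩
    refine ⟨⟨?_, ?_⟩, ?_, ?_⟩ <;> by_contra! <;> nlinarith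
  · rintro ⟨⟨h1, h2⟩, h3, h4⟩
    refine ⟨?_, ?_, ?_, ?_⟩ <;> nlinarith

/-- Both sides are multiples of Lebesgue measure restricted to the square, and total mass one
identifies the factors. -/
lemma uniformLaw_square (a : ℝ) {D : ℝ} (hD : 0 < D) :
    uniformLaw (square a D) = (unifIcc.prod unifIcc).map (squareParam a D) := by
  have hm := (continuous_squareParam a D).measurable
  have h : (unifIcc.prod unifIcc).map (squareParam a D) =
      (ENNReal.ofReal D⁻¹ * ENNReal.ofReal D⁻¹) • volume.restrict (square a D) := by
    rw [unifIcc, Measure.prod_restrict, ← squareParam_preimage a hD, ← Measure.volume_eq_prod,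
      ← Measure.restrict_map hm (measurableSet_square a D), map_volume_squareParam a hD,
      Measure.restrict_smul]
  have h1 : (unifIcc.prod unifIcc).map (squareParam a D) Set.univ = 1 := by
    rw [Measure.map_apply hm MeasurableSet.univ]; simp
  rw [h, uniformLaw, ProbabilityTheory.cond]
  rw [h, Measure.smul_apply, Measure.restrict_apply_univ, smul_eq_mul] at h1
  rw [ENNReal.eq_inv_of_mul_eq_one_left h1]

lemma isProbabilityMeasure_uniformLaw (a : ℝ) {D : ℝ} (hD : 0 < D) :
    IsProbabilityMeasure (uniformLaw (square a D)) := by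
  rw [uniformLaw_square a hD]
  exact Measure.isProbabilityMeasure_map (continuous_squareParam a D).measurable.aemeasurable

lemma ae_mem_square (a D : ℝ) : ∀ᵐ p ∂(uniformLaw (square a D)), p ∈ square a D :=
  ProbabilityTheory.ae_cond_mem (measurableSet_square a D)

end UnitSquare

/-! ### The kernel between vertical lines -/

section Kernel

/-- The one-dimensional line-of-sight kernel at horizontal distance `l`. -/
def losKernel (l c K v t : ℝ) : ℂ :=
  ((c / hypot l (v - t) : ℝ) : ℂ) * Complex.exp (-Complex.I * ((K * hypot l (v - t) : ℝ) : ℂ))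

variable {l l' c K : ℝ}

lemma norm_ofReal_mul_exp (x y : ℝ) : ‖(x : ℂ) * Complex.exp (-Complex.I * (y : ℂ))‖ = |x| := by
  rw [norm_mul, Complex.norm_real, Complex.norm_exp]
  simp

lemma norm_losKernel_le (hl : 1 ≤ l) (hc : 0 < c) (hcl : c ≤ 2 * l) (v t : ℝ) :
    ‖losKernel l c K v t‖ ≤ 2 := by
  have hp := hypot_pos (by linarith : 0 < l) (v - t)
  rw [losKernel, norm_ofReal_mul_exp, abs_of_pos (by positivity), div_le_iff₀ hp]
  linarith [le_hypot l (v - t)]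

lemma continuous_losKernel (hl : 1 ≤ l) : Continuous (Function.uncurry (losKernel l c K)) := by
  have h := continuous_hypot (l := l)
  have : Continuous fun p : ℝ × ℝ => c / hypot l (p.1 - p.2) :=
    continuous_const.div (by fun_prop) fun p => (hypot_pos (by linarith) _).ne'
  unfold losKernel Function.uncurry
  fun_prop

/-- The integration point runs over a single vertical line, so the two phases combine into that of a
path difference. The ratio c/l ≤ 2 turns 39 into 78. -/
lemma norm_gramKernel_losKernel_le (hl : 1 ≤ l) (hc : 0 < c) (hcl : c ≤ 2 * l) (hK : 0 < K)
    {t t' : ℝ} (ht : t ∈ Set.Icc (0 : ℝ) 1) (ht' : t' ∈ Set.Icc (0 : ℝ) 1) (hne : t ≠ t') :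
    ‖gramKernel unifIcc (fun t v => losKernel l c K v t) t t'‖ ≤ 78 * c / (K * |t - t'|) := by
  have hl0 : 0 < l := by linarith
  have hτ : 0 < |t - t'| := abs_pos.2 (sub_ne_zero.2 hne)
  have e : gramKernel unifIcc (fun t v => losKernel l c K v t) t t' =
      ((c ^ 2 : ℝ) : ℂ) * ∫ v in (0 : ℝ)..1,
        ((1 / (hypot l (v - t) * hypot l (v - t')) : ℝ) : ℂ) *
      Complex.exp (Complex.I * ((K * (hypot l (v - t') - hypot l (v - t)) : ℝ) : ℂ)) := by
    rw [gramKernel, integral_unifIcc, ← intervalIntegral.integral_const_mul]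
    refine intervalIntegral.integral_congr fun v _ => ?_
    have h1 := hypot_pos hl0 (v - t)
    have h2 := hypot_pos hl0 (v - t')
    have e1 : Complex.exp (Complex.I * ((K * (hypot l (v - t') - hypot l (v - t)) : ℝ) : ℂ)) =
        Complex.exp (-Complex.I * ((K * hypot l (v - t) : ℝ) : ℂ)) *
        Complex.exp (Complex.I * ((K * hypot l (v - t') : ℝ) : ℂ)) := by
      rw [← Complex.exp_add]; congr 1; push_cast; ring
    simp only [losKernel, map_mul, ← Complex.exp_conj, Complex.conj_ofReal, map_neg,
      Complex.conj_I, neg_neg, e1]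
    have e2 : c / hypot l (v - t) * (c / hypot l (v - t')) =
        c ^ 2 * (1 / (hypot l (v - t) * hypot l (v - t'))) := by field_simp
    have e3 := congrArg (fun x : ℝ => (x : ℂ)) e2
    simp only [Complex.ofReal_mul _ _] at e3 ⊢
    linear_combination e3 * (Complex.exp (-Complex.I * ((K : ℂ) * (hypot l (v - t) : ℂ))) *
        Complex.exp (Complex.I * ((K : ℂ) * (hypot l (v - t') : ℂ))))
  rw [e, norm_mul, Complex.norm_real, Real.norm_of_nonneg (sq_nonneg c)]
  calc _ ≤ c ^ 2 * (39 / (l * K * |t - t'|)) := by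
        gcongr
        exact norm_integral_hypot_phase_le hl hK ht ht' hne
    _ = c * (39 / (K * |t - t'|)) * (c / l) := by field_simp
    _ ≤ c * (39 / (K * |t - t'|)) * 2 := by
        gcongr
        rwa [div_le_iff₀ hl0]
    _ = _ := by ring

lemma integral_inv_one_add_sq_le {b : ℝ} (hb : 0 < b) :
    ∫ p, (1 + (b * (p.2 - p.1)) ^ 2)⁻¹ ∂(unifIcc.prod unifIcc) ≤ Real.pi / b := by
  have hint : Integrable (fun p : ℝ × ℝ => (1 + (b * (p.2 - p.1)) ^ 2)⁻¹)
      (unifIcc.prod unifIcc) := by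
    refine Integrable.of_bound (Measurable.aestronglyMeasurable (by fun_prop)) 1
      (ae_of_all _ fun p => ?_)
    rw [Real.norm_of_nonneg (by positivity)]
    exact inv_le_one_of_one_le₀ (by nlinarith [sq_nonneg (b * (p.2 - p.1))])
  rw [integral_prod _ hint]
  have h : ∀ x : ℝ, ∫ y, (1 + (b * (y - x)) ^ 2)⁻¹ ∂unifIcc ≤ Real.pi / b := by
    intro x
    have hi : Integrable (fun y : ℝ => (1 + (b * (y - x)) ^ 2)⁻¹) :=
      (integrable_inv_one_add_sq.comp_mul_left' hb.ne').comp_sub_right x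
    calc ∫ y, (1 + (b * (y - x)) ^ 2)⁻¹ ∂unifIcc ≤ ∫ y, (1 + (b * (y - x)) ^ 2)⁻¹ :=
          setIntegral_le_integral hi (ae_of_all _ fun y => by positivity)
      _ = Real.pi / b := by
          rw [integral_sub_right_eq_self (fun y => (1 + (b * y) ^ 2)⁻¹) x,
            Measure.integral_comp_mul_left (fun y => (1 + y ^ 2)⁻¹) b,
            integral_univ_inv_one_add_sq, abs_of_pos (inv_pos.2 hb), smul_eq_mul]
          ring
  calc _ ≤ ∫ x, Real.pi / b ∂unifIcc :=
        integral_mono hint.integral_prod_left (integrable_const _) h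
    _ = _ := by simp

lemma ae_ne_unifIcc_prod : ∀ᵐ p ∂(unifIcc.prod unifIcc),
    p.1 ∈ Set.Icc (0 : ℝ) 1 ∧ p.2 ∈ Set.Icc (0 : ℝ) 1 ∧ p.1 ≠ p.2 := by
  have h1 : ∀ᵐ p ∂(unifIcc.prod unifIcc), p.1 ∈ Set.Icc (0 : ℝ) 1 :=
    Measure.quasiMeasurePreserving_fst.ae ae_unifIcc
  have h2 : ∀ᵐ p ∂(unifIcc.prod unifIcc), p.2 ∈ Set.Icc (0 : ℝ) 1 :=
    Measure.quasiMeasurePreserving_snd.ae ae_unifIcc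
  have h3 : ∀ᵐ p ∂(unifIcc.prod unifIcc), p.1 ≠ p.2 := by
    have hm : MeasurableSet {p : ℝ × ℝ | p.1 ≠ p.2} :=
      (measurableSet_eq_fun measurable_fst measurable_snd).compl
    rw [Measure.ae_prod_iff_ae_ae hm]
    refine ae_of_all _ fun x => ?_
    have : NullSingletonClass unifIcc :=
      inferInstanceAs (NullSingletonClass (volume.restrict (Set.Icc (0 : ℝ) 1)))
    have := (measure_singleton (μ := unifIcc) x)
    rw [ae_iff]
    convert! this using 2
    ext y; simp [eq_comm]
  filter_upwards [h1, h2, h3] with p a b c using ⟨a, b, c⟩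

/-- The modulus g of the Gram kernel satisfies both g² ≤ 16 and g²(b(t - t'))² ≤ 1. Adding the two
gives a Lorentzian majorant with factor 17, whose integral over the whole line is finite; no
logarithm is lost. -/
lemma integral_norm_sq_gramKernel_losKernel_le (hl : 1 ≤ l) (hc : 0 < c) (hcl : c ≤ 2 * l)
    (hK : 0 < K) :
    ∫ q, ‖gramKernel unifIcc (fun t v => losKernel l c K v t) q.1 q.2‖ ^ 2
      ∂(unifIcc.prod unifIcc) ≤ 17 * (Real.pi / (K / (78 * c))) := by
  set b := K / (78 * c) with hb
  have hb0 : 0 < b := by positivity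
  have hI : ∀ p : ℝ × ℝ, 0 < 1 + (b * (p.2 - p.1)) ^ 2 := fun p => by positivity
  refine le_trans ?_ (mul_le_mul_of_nonneg_left (integral_inv_one_add_sq_le hb0) (by norm_num))
  rw [← integral_const_mul]
  refine integral_mono_of_nonneg (ae_of_all _ fun _ => sq_nonneg _) ?_ ?_
  · refine Integrable.of_bound (Measurable.aestronglyMeasurable (by fun_prop)) 17
      (ae_of_all _ fun p => ?_)
    rw [Real.norm_of_nonneg (by have := hI p; positivity)]
    have := inv_le_one_of_one_le₀ (a := 1 + (b * (p.2 - p.1)) ^ 2)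
      (by nlinarith [sq_nonneg (b * (p.2 - p.1))])
    linarith
  · filter_upwards [ae_ne_unifIcc_prod] with p hp
    have h1 := norm_gramKernel_le (ν := unifIcc) (a := fun t v => losKernel l c K v t) (b := 2)
      (fun t v => norm_losKernel_le hl hc hcl v t) p.1 p.2
    have h2 := norm_gramKernel_losKernel_le hl hc hcl hK hp.1 hp.2.1 hp.2.2
    set g := ‖gramKernel unifIcc (fun t v => losKernel l c K v t) p.1 p.2‖ with hg
    have hτ : 0 < |p.1 - p.2| := abs_pos.2 (sub_ne_zero.2 hp.2.2)
    have h3 : g * (b * |p.1 - p.2|) ≤ 1 := by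
      calc _ ≤ 78 * c / (K * |p.1 - p.2|) * (b * |p.1 - p.2|) := by gcongr
        _ = 1 := by rw [hb]; field_simp
    have hg0 : 0 ≤ g := norm_nonneg _
    have h4 : g ^ 2 * (b * (p.2 - p.1)) ^ 2 ≤ 1 := by
      have : g ^ 2 * (b * (p.2 - p.1)) ^ 2 = (g * (b * |p.1 - p.2|)) ^ 2 := by
        rw [mul_pow g, mul_pow b, mul_pow b, sq_abs]; ring
      rw [this]
      exact pow_le_one₀ (by positivity) h3
    have h5 : g ^ 2 ≤ 16 := by nlinarith
    rw [← div_eq_mul_inv, le_div_iff₀ (hI p)]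
    linarith

/-- Mean-square decorrelation of two receivers on vertical lines. -/
lemma integral_norm_sq_losKernel_pair_le (hl : 1 ≤ l) (hl' : 1 ≤ l') (hc : 0 < c)
    (hcl : c ≤ 2 * l) (hcl' : c ≤ 2 * l') (hK : 0 < K) :
    ∫ p, ‖∫ t, losKernel l c K p.1 t * (starRingEnd ℂ) (losKernel l' c K p.2 t) ∂unifIcc‖ ^ 2
      ∂(unifIcc.prod unifIcc) ≤ 17 * (Real.pi / (K / (78 * c))) := by
  have hA := (continuous_losKernel (c := c) (K := K) hl).measurable
  have hB := (continuous_losKernel (c := c) (K := K) hl').measurable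
  have hA' := measurable_uncurry_flip hA
  have hB' := measurable_uncurry_flip hB
  have h := integral_norm_sq_eq_integral_gramKernel (ν := unifIcc) (μ := unifIcc)
    (μ' := unifIcc) hA hB (norm_losKernel_le hl hc hcl) (norm_losKernel_le hl' hc hcl')
  have iA := (memLp_gramKernel (ν := unifIcc) (μ := unifIcc) hA'
    (fun t v => norm_losKernel_le hl hc hcl v t) 2).norm.integrable_sq
  have iB := (memLp_gramKernel (ν := unifIcc) (μ := unifIcc) hB'
    (fun t v => norm_losKernel_le hl' hc hcl' v t) 2).norm.integrable_sq
  have hnn : 0 ≤ ∫ p, ‖∫ t, losKernel l c K p.1 t * (starRingEnd ℂ) (losKernel l' c K p.2 t)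
      ∂unifIcc‖ ^ 2 ∂(unifIcc.prod unifIcc) := integral_nonneg fun _ => sq_nonneg _
  refine (Complex.norm_of_nonneg hnn).symm.le.trans ?_
  -- For `l ≠ l'` the phase in `t` can have stationary points. Duality leaves the inner product of
  -- two Gram kernels, each with a single value of `l`, and the arithmetic-geometric mean inequality
  -- separates them.
  rw [h]
  calc _ ≤ ∫ q, (1 / 2 : ℝ) * (‖gramKernel unifIcc (fun t v => losKernel l c K v t) q.1 q.2‖ ^ 2 +
        ‖gramKernel unifIcc (fun t v => losKernel l' c K v t) q.1 q.2‖ ^ 2)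
          ∂(unifIcc.prod unifIcc) := by
        refine norm_integral_le_of_norm_le ((iA.add iB).const_mul _) (ae_of_all _ fun q => ?_)
        rw [norm_mul, RCLike.norm_conj]
        nlinarith [sq_nonneg (‖gramKernel unifIcc (fun t v => losKernel l c K v t) q.1 q.2‖ -
          ‖gramKernel unifIcc (fun t v => losKernel l' c K v t) q.1 q.2‖)]
    _ ≤ _ := by
        rw [integral_const_mul, integral_add iA iB]
        have a1 := integral_norm_sq_gramKernel_losKernel_le hl hc hcl hK
        have a2 := integral_norm_sq_gramKernel_losKernel_le hl' hc hcl' hK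
        linarith

end Kernel
end

noncomputable section

/-! ### Reordering of coordinates -/

section Fubini

lemma integrable_comp_of_abs_le {β γ : Type*} [MeasurableSpace β] [MeasurableSpace γ]
    {Φ : β → ℝ} (hΦ : Measurable Φ) {C : ℝ} (hC : ∀ q, |Φ q| ≤ C) (ρ : Measure γ)
    [IsFiniteMeasure ρ] (g : γ → β) (hg : Measurable g) : Integrable (fun x => Φ (g x)) ρ :=
  Integrable.of_bound (hΦ.comp hg).aestronglyMeasurable C (ae_of_all _ fun _ => hC _)

/-- Fubini with the first coordinates outermost, so that a bound in the second coordinates for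
almost all fixed first ones suffices. -/
lemma integral_prod_prod_le {α β : Type*} [MeasurableSpace α] [MeasurableSpace β]
    {μ : Measure α} {ν : Measure β} [IsProbabilityMeasure μ] [IsProbabilityMeasure ν]
    {Φ : (α × β) × (α × β) → ℝ} (hΦ : Measurable Φ) {C c : ℝ} (hC : ∀ q, |Φ q| ≤ C)
    (h : ∀ᵐ u ∂μ, ∀ᵐ u' ∂μ, ∫ p : β × β, Φ ((u, p.1), (u', p.2)) ∂(ν.prod ν) ≤ c) :
    ∫ q, Φ q ∂((μ.prod ν).prod (μ.prod ν)) ≤ c := by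
  have e : ∀ u, ∫ v, ∫ p : α × β, Φ ((u, v), p) ∂(μ.prod ν) ∂ν =
      ∫ u', ∫ p : β × β, Φ ((u, p.1), (u', p.2)) ∂(ν.prod ν) ∂μ := by
    intro u
    calc _ = ∫ q : β × (α × β), Φ ((u, q.1), q.2) ∂(ν.prod (μ.prod ν)) :=
          (integral_prod _ (integrable_comp_of_abs_le hΦ hC _ (fun q : β × (α × β) => ((u, q.1), q.2)) (by fun_prop))).symm
      _ = ∫ v, ∫ u', ∫ v', Φ ((u, v), (u', v')) ∂ν ∂μ ∂ν := by
          rw [integral_prod _ (integrable_comp_of_abs_le hΦ hC _ (fun q : β × (α × β) => ((u, q.1), q.2)) (by fun_prop))]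
          refine integral_congr_ae (ae_of_all _ fun v => ?_)
          exact integral_prod _ (integrable_comp_of_abs_le hΦ hC _ (fun q : α × β => ((u, v), q)) (by fun_prop))
      _ = ∫ u', ∫ v, ∫ v', Φ ((u, v), (u', v')) ∂ν ∂ν ∂μ := by
          refine integral_integral_swap ?_
          exact (integrable_comp_of_abs_le hΦ hC ((ν.prod μ).prod ν) (fun q : (β × α) × β => ((u, q.1.1), (q.1.2, q.2)))
            (by fun_prop)).integral_prod_left
      _ = _ := by
          refine integral_congr_ae (ae_of_all _ fun u' => ?_)
          exact (integral_prod _ (integrable_comp_of_abs_le hΦ hC _ (fun q : β × β => ((u, q.1), (u', q.2)))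
            (by fun_prop))).symm
  have i1 : Integrable Φ ((μ.prod ν).prod (μ.prod ν)) :=
    integrable_comp_of_abs_le hΦ hC _ id measurable_id
  have i2 : Integrable (fun q : α × (α × (β × β)) => Φ ((q.1, q.2.2.1), (q.2.1, q.2.2.2)))
    (μ.prod (μ.prod (ν.prod ν))) := integrable_comp_of_abs_le hΦ hC _ _ (by fun_prop)
  have i3 := fun u => integrable_comp_of_abs_le hΦ hC (μ.prod (ν.prod ν))
    (fun q : α × (β × β) => ((u, q.2.1), (q.1, q.2.2))) (by fun_prop)
  rw [integral_prod _ i1, integral_prod _ i1.integral_prod_left]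
  simp only [e]
  have i4 : Integrable (fun u => ∫ u', ∫ p : β × β, Φ ((u, p.1), (u', p.2)) ∂(ν.prod ν) ∂μ) μ := by
    refine i2.integral_prod_left.congr (ae_of_all _ fun u => ?_)
    exact integral_prod _ (i3 u)
  calc _ ≤ ∫ u, c ∂μ := by
        refine integral_mono_ae i4 (integrable_const _) ?_
        filter_upwards [h] with u hu
        calc _ ≤ ∫ u', c ∂μ := integral_mono_ae (i3 u).integral_prod_left (integrable_const _) hu
          _ = c := by simp
    _ = c := by simp

end Fubini

/-! ### Mean squared correlation of two receivers -/

section Trunc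

/-- The normalized line-of-sight kernel, with the distance in the amplitude bounded below. -/
def truncKernel (L wl : ℝ) (y x : Plane) : ℂ :=
  ((L / max (dist y x) (L / 2) : ℝ) : ℂ) *
    Complex.exp (-Complex.I * ((2 * Real.pi / wl * dist y x : ℝ) : ℂ))

variable {L wl D : ℝ}

lemma norm_truncKernel_le (hL : 0 < L) (y x : Plane) : ‖truncKernel L wl y x‖ ≤ 2 := by
  have h : L / 2 ≤ max (dist y x) (L / 2) := le_max_right _ _
  have hp : 0 < max (dist y x) (L / 2) := by linarith
  rw [truncKernel, norm_ofReal_mul_exp, abs_of_pos (by positivity), div_le_iff₀ hp]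
  linarith

lemma measurable_truncKernel : Measurable (Function.uncurry (truncKernel L wl)) := by
  unfold truncKernel Function.uncurry
  fun_prop

lemma dist_squareParam (hD : 0 < D) (u v s t : ℝ) :
    dist (squareParam L D (u, v)) (squareParam 0 D (s, t)) =
      D * hypot ((L + D * (u - s)) / D) (v - t) := by
  rw [EuclideanSpace.dist_eq, Fin.sum_univ_two]
  simp only [squareParam, Matrix.cons_val_zero, Matrix.cons_val_one, Real.dist_eq, sq_abs]
  rw [hypot, ← Real.sqrt_sq hD.le, ← Real.sqrt_mul (sq_nonneg D), Real.sqrt_sq hD.le]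
  congr 1
  field_simp
  ring

/-- The horizontal gap between the squares is at least L/2, so the truncation is inactive there.
Measuring lengths in units of D gives the one-dimensional kernel. -/
lemma truncKernel_squareParam (hD : 0 < D) (hL : 2 * D ≤ L) {u s : ℝ}
    (hu : u ∈ Set.Icc (0 : ℝ) 1) (hs : s ∈ Set.Icc (0 : ℝ) 1) (v t : ℝ) :
    truncKernel L wl (squareParam L D (u, v)) (squareParam 0 D (s, t)) =
      losKernel ((L + D * (u - s)) / D) (L / D) (2 * Real.pi * D / wl) v t := by
  have h1 : L / 2 ≤ D * hypot ((L + D * (u - s)) / D) (v - t) := by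
    have := le_hypot ((L + D * (u - s)) / D) (v - t)
    rw [div_le_iff₀ hD] at this
    nlinarith [hu.1, hs.2]
  rw [truncKernel, losKernel, dist_squareParam hD, max_eq_left h1]
  have e1 : ∀ h : ℝ, L / (D * h) = L / D / h := fun h => (div_div _ _ _).symm
  have e2 : ∀ h : ℝ, 2 * Real.pi / wl * (D * h) = 2 * Real.pi * D / wl * h := fun h => by ring
  rw [e1, e2]

/-- Jensen's inequality pulls the transmitter's horizontal coordinate out of the square. With the
receivers' horizontal coordinates frozen as well, what remains is the estimate for a pair of
vertical lines. -/
lemma integral_norm_sq_gramKernel_truncKernel_le (hD : 0 < D) (hL : 2 * D ≤ L) (hwl : 0 < wl) :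
    ∫ p, ‖gramKernel (uniformLaw (square 0 D)) (truncKernel L wl) p.1 p.2‖ ^ 2
      ∂((uniformLaw (square L D)).prod (uniformLaw (square L D))) ≤ 663 * (wl * L / D ^ 2) := by
  have hL0 : 0 < L := by linarith
  set c := L / D with hc
  set K := 2 * Real.pi * D / wl with hK
  have hc0 : 0 < c := by positivity
  have hK0 : 0 < K := by positivity
  -- 78πc/K = 39 λL/D², and 17·39 = 663.
  have hconst : 17 * (Real.pi / (K / (78 * c))) = 663 * (wl * L / D ^ 2) := by
    rw [hc, hK]; field_simp; norm_num
  rw [← hconst]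
  have hmL := (continuous_squareParam L D).measurable
  have hm0 := (continuous_squareParam 0 D).measurable
  have htm := measurable_truncKernel (L := L) (wl := wl)
  -- the integrand with the horizontal coordinate of the transmitter fixed
  let Ψ : ℝ → (ℝ × ℝ) × (ℝ × ℝ) → ℂ := fun s q => ∫ t,
    truncKernel L wl (squareParam L D q.1) (squareParam 0 D (s, t)) *
      (starRingEnd ℂ) (truncKernel L wl (squareParam L D q.2) (squareParam 0 D (s, t))) ∂unifIcc
  have hbase : Measurable fun r : (((ℝ × ℝ) × (ℝ × ℝ)) × ℝ) × ℝ =>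
      truncKernel L wl (squareParam L D r.1.1.1) (squareParam 0 D (r.1.2, r.2)) *
      (starRingEnd ℂ) (truncKernel L wl (squareParam L D r.1.1.2) (squareParam 0 D (r.1.2, r.2))) := by
    have e1 := htm.comp (f := fun r : (((ℝ × ℝ) × (ℝ × ℝ)) × ℝ) × ℝ =>
      (squareParam L D r.1.1.1, squareParam 0 D (r.1.2, r.2))) (by fun_prop)
    have e2 := htm.comp (f := fun r : (((ℝ × ℝ) × (ℝ × ℝ)) × ℝ) × ℝ =>
      (squareParam L D r.1.1.2, squareParam 0 D (r.1.2, r.2))) (by fun_prop)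
    exact e1.mul (Complex.continuous_conj.measurable.comp e2)
  have hbd : ∀ y y' x : Plane, ‖truncKernel L wl y x * (starRingEnd ℂ) (truncKernel L wl y' x)‖ ≤ 4 := by
    intro y y' x
    rw [norm_mul, RCLike.norm_conj]
    have h1 := norm_truncKernel_le (wl := wl) hL0 y x
    have h2 := norm_truncKernel_le (wl := wl) hL0 y' x
    nlinarith [norm_nonneg (truncKernel L wl y x), norm_nonneg (truncKernel L wl y' x)]
  have hΨm : Measurable fun r : ((ℝ × ℝ) × (ℝ × ℝ)) × ℝ => Ψ r.2 r.1 :=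
    (StronglyMeasurable.integral_prod_right hbase.stronglyMeasurable).measurable
  have hΨb : ∀ s q, ‖Ψ s q‖ ≤ 4 := fun s q => by
    refine (norm_integral_le_of_norm_le_const (C := 4) (ae_of_all _ fun t => ?_)).trans (by simp)
    exact hbd _ _ _
  have hΨb2 : ∀ s q, |‖Ψ s q‖ ^ 2| ≤ 16 := fun s q => by
    rw [abs_of_nonneg (sq_nonneg _)]
    nlinarith [hΨb s q, norm_nonneg (Ψ s q)]
  have hgram : ∀ q : (ℝ × ℝ) × (ℝ × ℝ), gramKernel (uniformLaw (square 0 D)) (truncKernel L wl)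
      (squareParam L D q.1) (squareParam L D q.2) = ∫ s, Ψ s q ∂unifIcc := by
    intro q
    have hmx : Measurable fun x => truncKernel L wl (squareParam L D q.1) x *
        (starRingEnd ℂ) (truncKernel L wl (squareParam L D q.2) x) :=
      (htm.comp (f := fun x => (squareParam L D q.1, x)) (by fun_prop)).mul
        (Complex.continuous_conj.measurable.comp
          (htm.comp (f := fun x => (squareParam L D q.2, x)) (by fun_prop)))
    rw [gramKernel, uniformLaw_square 0 hD, integral_map hm0.aemeasurable
      hmx.aestronglyMeasurable, integral_prod]
    exact Integrable.of_bound (hmx.comp hm0).aestronglyMeasurable 4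
      (ae_of_all _ fun _ => hbd _ _ _)
  rw [uniformLaw_square L hD, Measure.map_prod_map _ _ hmL hmL, integral_map (by fun_prop)]
  swap
  · have : IsProbabilityMeasure (uniformLaw (square 0 D)) := isProbabilityMeasure_uniformLaw 0 hD
    exact ((measurable_gramKernel htm).norm.pow_const 2).aestronglyMeasurable
  simp only [Prod.map_fst, Prod.map_snd, hgram]
  have hint : Integrable (fun r : ((ℝ × ℝ) × (ℝ × ℝ)) × ℝ => ‖Ψ r.2 r.1‖ ^ 2)
      (((unifIcc.prod unifIcc).prod (unifIcc.prod unifIcc)).prod unifIcc) :=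
    Integrable.of_bound (hΨm.norm.pow_const 2).aestronglyMeasurable 16
      (ae_of_all _ fun r => hΨb2 _ _)
  have hjensen : ∀ q, ‖∫ s, Ψ s q ∂unifIcc‖ ^ 2 ≤ ∫ s, ‖Ψ s q‖ ^ 2 ∂unifIcc := fun q =>
    norm_integral_sq_le (MemLp.of_bound (hΨm.comp (f := fun s => (q, s))
      (by fun_prop)).aestronglyMeasurable 4 (ae_of_all _ fun s => hΨb s q))
  have hs : ∀ᵐ s ∂unifIcc, ∫ q, ‖Ψ s q‖ ^ 2
      ∂((unifIcc.prod unifIcc).prod (unifIcc.prod unifIcc)) ≤ 17 * (Real.pi / (K / (78 * c))) := by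
    filter_upwards [ae_unifIcc] with s hs
    have hΨs : Measurable (Ψ s) := hΨm.comp (f := fun q => (q, s)) (by fun_prop)
    refine integral_prod_prod_le (hΨs.norm.pow_const 2) (hΨb2 s) ?_
    filter_upwards [ae_unifIcc] with u hu
    filter_upwards [ae_unifIcc] with u' hu'
    have hl : ∀ u ∈ Set.Icc (0 : ℝ) 1, 1 ≤ (L + D * (u - s)) / D ∧
        c ≤ 2 * ((L + D * (u - s)) / D) := fun u hu => by
      constructor
      · rw [le_div_iff₀ hD]; nlinarith [hu.1, hs.2]
      · rw [hc, ← mul_div_assoc]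
        gcongr
        nlinarith [hu.1, hs.2]
    have := integral_norm_sq_losKernel_pair_le (hl u hu).1 (hl u' hu').1 hc0 (hl u hu).2
      (hl u' hu').2 hK0
    simpa only [Ψ, truncKernel_squareParam hD hL hu hs, truncKernel_squareParam hD hL hu' hs]
      using this
  calc _ ≤ ∫ q, ∫ s, ‖Ψ s q‖ ^ 2 ∂unifIcc
        ∂((unifIcc.prod unifIcc).prod (unifIcc.prod unifIcc)) :=
        integral_mono_of_nonneg (ae_of_all _ fun q => sq_nonneg _) hint.integral_prod_left
          (ae_of_all _ hjensen)
    _ = ∫ s, ∫ q, ‖Ψ s q‖ ^ 2 ∂((unifIcc.prod unifIcc).prod (unifIcc.prod unifIcc)) ∂unifIcc :=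
        integral_integral_swap hint
    _ ≤ ∫ s, 17 * (Real.pi / (K / (78 * c))) ∂unifIcc :=
        integral_mono_ae hint.integral_prod_right (integrable_const _) hs
    _ = _ := by simp

/-- The logarithm in M is not needed by the method: the decorrelation estimate holds without it and
is the stronger one. -/
lemma dofM_le_max (D L wl : ℝ) (hD : 0 < D) (hL : 0 < L) (hwl : 0 < wl) :
    dofM D L wl ≤ max 1 (D ^ 2 / (wl * L)) := by
  refine max_le_max le_rfl ?_
  refine mul_le_of_le_one_right (by positivity) (inv_le_one_of_one_le₀ ?_)
  linarith [le_max_right (Real.logb 2 (D ^ 2 / (wl * L))) 0]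

lemma one_le_dofM (D L wl : ℝ) : 1 ≤ dofM D L wl := le_max_left _ _

/-- The mean squared Gram kernel of the receivers is `O(1 / M)`. -/
lemma integral_norm_sq_gramKernel_truncKernel_le_dofM (hD : 0 < D) (hL : 2 * D ≤ L)
    (hwl : 0 < wl) :
    ∫ p, ‖gramKernel (uniformLaw (square 0 D)) (truncKernel L wl) p.1 p.2‖ ^ 2
      ∂((uniformLaw (square L D)).prod (uniformLaw (square L D))) ≤ 663 * (dofM D L wl)⁻¹ := by
  have hL0 : 0 < L := by linarith
  have hM := dofM_le_max D L wl hD hL0 hwl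
  have hM1 := one_le_dofM D L wl
  rcases le_total 1 (D ^ 2 / (wl * L)) with h | h
  · refine (integral_norm_sq_gramKernel_truncKernel_le hD hL hwl).trans ?_
    rw [max_eq_right h] at hM
    gcongr
    rw [← inv_div]
    exact inv_anti₀ (by linarith) hM
  -- Here M = 1, and the trivial bound 4² for the squared Gram kernel suffices.
  · rw [max_eq_left h] at hM
    have hM' : dofM D L wl = 1 := le_antisymm hM hM1
    have := isProbabilityMeasure_uniformLaw 0 hD
    have := isProbabilityMeasure_uniformLaw L hD
    have hg := norm_gramKernel_le (ν := uniformLaw (square 0 D))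
      (norm_truncKernel_le (wl := wl) hL0)
    calc _ ≤ ∫ p, (16 : ℝ) ∂((uniformLaw (square L D)).prod (uniformLaw (square L D))) := by
          refine integral_mono_of_nonneg (ae_of_all _ fun _ => sq_nonneg _) (integrable_const _)
            (ae_of_all _ fun p => ?_)
          have := hg p.1 p.2
          simp only
          nlinarith [norm_nonneg (gramKernel (uniformLaw (square 0 D)) (truncKernel L wl) p.1 p.2)]
      _ ≤ _ := by rw [hM']; simp; norm_num

end Trunc
end

noncomputable section

/-! ### Empirical measures -/

section Empirical

variable {Z : Type*} [MeasurableSpace Z] {N : ℕ}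

/-- The empirical measure of a sample. -/
def empirical (y : Fin N → Z) : Measure Z := (N : ℝ≥0∞)⁻¹ • ∑ i, Measure.dirac (y i)

lemma isProbabilityMeasure_empirical (hN : 0 < N) (y : Fin N → Z) :
    IsProbabilityMeasure (empirical y) := by
  refine ⟨?_⟩
  simp only [empirical, Measure.smul_apply, Measure.finsetSum_apply, measure_univ, smul_eq_mul,
    Finset.sum_const, Finset.card_univ, Fintype.card_fin, nsmul_eq_mul, mul_one]
  exact ENNReal.inv_mul_cancel (by exact_mod_cast hN.ne') (ENNReal.natCast_ne_top N)

lemma integral_empirical [MeasurableSingletonClass Z] {E : Type*} [NormedAddCommGroup E]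
    [NormedSpace ℝ E] [CompleteSpace E] (y : Fin N → Z) (f : Z → E) :
    ∫ z, f z ∂(empirical y) = (N : ℝ)⁻¹ • ∑ i, f (y i) := by
  rw [empirical, integral_smul_measure, integral_finsetSum_measure]
  · simp
  · intro i _
    exact integrable_dirac enorm_lt_top

end Empirical

/-! ### The high-probability event for the positions -/

section Event

variable {D L wl : ℝ} {N : ℕ}

/-- The squared Frobenius norm of the Gram matrix of the normalized channel. -/
def gramSum (L wl : ℝ) (tx rx : Fin N → Plane) : ℝ :=
  ∑ k, ∑ l, ‖∑ i, truncKernel L wl (rx i) (tx k) * (starRingEnd ℂ) (truncKernel L wl (rx i) (tx l))‖ ^ 2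

lemma measurable_gramSum : Measurable fun z : (Fin N → Plane) × (Fin N → Plane) =>
    gramSum L wl z.1 z.2 := by
  have h := measurable_truncKernel (L := L) (wl := wl)
  unfold gramSum
  refine Finset.measurable_sum _ fun k _ => Finset.measurable_sum _ fun l _ => ?_
  refine (Finset.measurable_sum _ fun i _ => ?_).norm.pow_const 2
  exact (h.comp (f := fun z : (Fin N → Plane) × (Fin N → Plane) => (z.2 i, z.1 k)) (by fun_prop)).mul
    (Complex.continuous_conj.measurable.comp
      (h.comp (f := fun z : (Fin N → Plane) × (Fin N → Plane) => (z.2 i, z.1 l)) (by fun_prop)))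

/-- Given the receivers, `gramSum` is N² times the squared Frobenius norm of the transmitters' Gram
matrix under the empirical measure of the receivers. By duality the mean square of that kernel is
N⁻² times the double sum over the receivers, which the hypothesis controls. -/
lemma measure_gramSum_gt_le (hD : 0 < D) (hL : 2 * D ≤ L) (hN : 0 < N) {τ : ℝ}
    (hτN : 1 / (N : ℝ) ≤ τ) (rx : Fin N → Plane)
    (hrx : ∑ i, ∑ j, ‖gramKernel (uniformLaw (square 0 D)) (truncKernel L wl) (rx i) (rx j)‖ ^ 2 ≤
      N ^ 2 * τ) :
    (Measure.pi fun _ : Fin N => uniformLaw (square 0 D))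
      {tx | 18 * N ^ 4 * τ < gramSum L wl tx rx} ≤ ENNReal.ofReal (48 / √N) := by
  have hL0 : 0 < L := by linarith
  have hNpos : (0 : ℝ) < N := by exact_mod_cast hN
  have := isProbabilityMeasure_uniformLaw 0 hD
  have := isProbabilityMeasure_empirical hN rx
  have htm := measurable_truncKernel (L := L) (wl := wl)
  have hb := norm_truncKernel_le (wl := wl) hL0
  have htm' := measurable_uncurry_flip htm
  have hm : ∫ p, ‖gramKernel (empirical rx) (fun x y => truncKernel L wl y x) p.1 p.2‖ ^ 2
      ∂((uniformLaw (square 0 D)).prod (uniformLaw (square 0 D))) ≤ τ := by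
    rw [gramKernel_duality htm' (fun x y => hb y x), integral_prod]
    · simp only [integral_empirical, smul_eq_mul, ← Finset.mul_sum]
      rw [← mul_assoc, ← mul_inv, ← sq, inv_mul_le_iff₀ (by positivity)]
      exact hrx
    · exact (memLp_gramKernel (ν := uniformLaw (square 0 D)) htm hb 2).norm.integrable_sq
  have key := gramKernel_concentration htm' (fun x y => hb y x) hN hτN hm
  -- The bound `b = 2` gives 2 + b⁴ = 18 and 4b² + 2b⁴ = 48.
  norm_num at key
  refine le_trans (le_of_eq ?_) key
  congr 1
  ext tx
  simp only [Set.mem_ofPred_eq, gramSum, gramKernel, integral_empirical, norm_smul, mul_pow,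
    ← Finset.mul_sum, norm_inv, Real.norm_natCast]
  rw [inv_pow, lt_inv_mul_iff₀ (by positivity)]
  ring_nf

/-- With high probability, the Gram sum is at most of the order of `N ^ 4 * max (1 / N) (1 / M)`. -/
lemma nodeLaw_gramSum_gt_le (hD : 0 < D) (hL : 2 * D ≤ L) (hwl : 0 < wl) (hN : 0 < N) :
    nodeLaw N D L {z | 214812 * N ^ 4 * max (1 / (N : ℝ)) (dofM D L wl)⁻¹ < gramSum L wl z.1 z.2} ≤
      ENNReal.ofReal (96 / √N) := by
  have hL0 : 0 < L := by linarith
  have := isProbabilityMeasure_uniformLaw 0 hD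
  have := isProbabilityMeasure_uniformLaw L hD
  have htm := measurable_truncKernel (L := L) (wl := wl)
  have hb := norm_truncKernel_le (wl := wl) hL0
  set w := max (1 / (N : ℝ)) (dofM D L wl)⁻¹ with hw
  have hw1 : 1 / (N : ℝ) ≤ w := le_max_left _ _
  have hw2 : (dofM D L wl)⁻¹ ≤ w := le_max_right _ _
  have hw0 : 0 ≤ w := le_trans (by positivity) hw1
  have key := gramKernel_concentration (N := N) (τ := 663 * w) htm hb hN (by linarith)
    ((integral_norm_sq_gramKernel_truncKernel_le_dofM hD hL hwl).trans (by linarith))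
  norm_num at key
  set E : Set ((Fin N → Plane) × (Fin N → Plane)) :=
    {z | 214812 * N ^ 4 * w < gramSum L wl z.1 z.2} with hE
  have hEm : MeasurableSet E := measurableSet_lt measurable_const measurable_gramSum
  set B : Set (Fin N → Plane) := {x | 18 * (N : ℝ) ^ 2 * (663 * w) <
    ∑ k, ∑ l, ‖gramKernel (uniformLaw (square 0 D)) (truncKernel L wl) (x k) (x l)‖ ^ 2} with hB
  have hBm : MeasurableSet B := by
    refine measurableSet_lt measurable_const ?_
    refine Finset.measurable_sum _ fun k _ => Finset.measurable_sum _ fun l _ => ?_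
    exact ((measurable_gramKernel (ν := uniformLaw (square 0 D)) htm).comp
      (f := fun x : Fin N → Plane => (x k, x l)) (by fun_prop)).norm.pow_const 2
  rw [nodeLaw, Measure.prod_apply_symm hEm]
  calc _ ≤ ∫⁻ rx, (B.indicator 1 rx + ENNReal.ofReal (48 / √N))
        ∂(Measure.pi fun _ : Fin N => uniformLaw (square L D)) := by
        refine lintegral_mono fun rx => ?_
        by_cases hrx : rx ∈ B
        · simp only [Set.indicator_of_mem hrx, Pi.one_apply]
          exact prob_le_one.trans le_self_add
        · simp only [Set.indicator_of_notMem hrx, zero_add]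
          -- Outside `B` the receiver sum is at most N²·18·663 w = N²·11934 w, and the second stage
          -- multiplies by 18 again: 18·11934 = 214812.
          have h1 := measure_gramSum_gt_le (τ := 11934 * w) (wl := wl) hD hL hN (by linarith) rx (by
            simp only [hB, Set.mem_ofPred_eq, not_lt] at hrx
            linarith)
          refine le_trans (measure_mono fun tx htx => ?_) h1
          simp only [hE, Set.mem_preimage, Set.mem_ofPred_eq] at htx ⊢
          linarith
    _ ≤ ENNReal.ofReal (48 / √N) + ENNReal.ofReal (48 / √N) := by
        rw [lintegral_add_left (measurable_one.indicator hBm), lintegral_indicator_one hBm]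
        simp only [lintegral_const, measure_univ, mul_one]
        gcongr
    _ = _ := by
        rw [← ENNReal.ofReal_add (by positivity) (by positivity)]
        congr 1; ring

lemma dist_le_of_mem_square (hD : 0 < D) (hL : 2 * D ≤ L) {x y : Plane} (hx : x ∈ square 0 D)
    (hy : y ∈ square L D) : L / 2 ≤ dist y x ∧ dist y x ^ 2 ≤ 5 / 2 * L ^ 2 := by
  obtain ⟨x1, x2, x3, x4⟩ := hx
  obtain ⟨y1, y2, y3, y4⟩ := hy
  have h : dist y x ^ 2 = (y 0 - x 0) ^ 2 + (y 1 - x 1) ^ 2 := by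
    rw [EuclideanSpace.dist_eq, Fin.sum_univ_two, Real.sq_sqrt (by positivity)]
    simp [Real.dist_eq, sq_abs]
  constructor
  · refine le_of_sq_le_sq ?_ dist_nonneg
    rw [h]
    nlinarith [sq_nonneg (y 1 - x 1)]
  · rw [h]
    have a1 : (y 0 - x 0) ^ 2 ≤ (3 / 2 * L) ^ 2 := by
      apply sq_le_sq'  <;> linarith
    have a2 : (y 1 - x 1) ^ 2 ≤ (1 / 2 * L) ^ 2 := by
      apply sq_le_sq'  <;> linarith
    linarith

lemma channelMatrix_apply_eq (hD : 0 < D) (hL : 2 * D ≤ L) {G : ℝ} {tx rx : Fin N → Plane}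
    (htx : ∀ i, tx i ∈ square 0 D) (hrx : ∀ i, rx i ∈ square L D) (i k : Fin N) :
    channelMatrix G wl tx rx i k = ((√G / L : ℝ) : ℂ) * truncKernel L wl (rx i) (tx k) := by
  have hL0 : 0 < L := by linarith
  have h := (dist_le_of_mem_square hD hL (htx k) (hrx i)).1
  have e : √G / dist (rx i) (tx k) = √G / L * (L / dist (rx i) (tx k)) := by
    rw [div_mul_div_comm, mul_comm L, mul_div_mul_right _ _ hL0.ne']
  rw [channelMatrix, Matrix.of_apply, truncKernel, max_eq_left h, e, Complex.ofReal_mul, mul_assoc]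

lemma sum_norm_sq_gram_channelMatrix (hD : 0 < D) (hL : 2 * D ≤ L) {G : ℝ} (hG : 0 < G)
    {tx rx : Fin N → Plane} (htx : ∀ i, tx i ∈ square 0 D) (hrx : ∀ i, rx i ∈ square L D) :
    ∑ k, ∑ l, ‖((channelMatrix G wl tx rx)ᴴ * channelMatrix G wl tx rx) k l‖ ^ 2 =
      (G / L ^ 2) ^ 2 * gramSum L wl tx rx := by
  rw [gramSum, Finset.sum_comm, Finset.mul_sum]
  refine Finset.sum_congr rfl fun k _ => ?_
  rw [Finset.mul_sum]
  refine Finset.sum_congr rfl fun l _ => ?_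
  have e : ((channelMatrix G wl tx rx)ᴴ * channelMatrix G wl tx rx) l k =
      ((G / L ^ 2 : ℝ) : ℂ) * ∑ i, truncKernel L wl (rx i) (tx k) *
        (starRingEnd ℂ) (truncKernel L wl (rx i) (tx l)) := by
    rw [Matrix.mul_apply, Finset.mul_sum]
    refine Finset.sum_congr rfl fun i _ => ?_
    have hs : ((√G / L : ℝ) : ℂ) * ((√G / L : ℝ) : ℂ) = ((G / L ^ 2 : ℝ) : ℂ) := by
      rw [← Complex.ofReal_mul, div_mul_div_comm, Real.mul_self_sqrt hG.le, sq]
    rw [Matrix.conjTranspose_apply, channelMatrix_apply_eq hD hL htx hrx,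
      channelMatrix_apply_eq hD hL htx hrx, ← hs, star_mul', RCLike.star_def,
      Complex.conj_ofReal]
    ring
  rw [e, norm_mul, Complex.norm_real, mul_pow, Real.norm_eq_abs, sq_abs]

lemma trace_conjTranspose_mul_self_re (A : Matrix (Fin N) (Fin N) ℂ) :
    (Aᴴ * A).trace.re = ∑ k, ∑ i, ‖A i k‖ ^ 2 := by
  rw [Matrix.trace, Complex.re_sum]
  refine Finset.sum_congr rfl fun k _ => ?_
  rw [Matrix.diag_apply, Matrix.mul_apply, Complex.re_sum]
  refine Finset.sum_congr rfl fun i _ => ?_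
  rw [Matrix.conjTranspose_apply, RCLike.star_def, mul_comm, Complex.mul_conj,
    Complex.normSq_eq_norm_sq, Complex.ofReal_re]

/-- No randomness is involved: all squared distances are at most (3L/2)² + (L/2)² = 5L²/2, whence
the factor 2/5. -/
lemma trace_gram_channelMatrix_ge (hD : 0 < D) (hL : 2 * D ≤ L) {G : ℝ} (hG : 0 < G)
    {tx rx : Fin N → Plane} (htx : ∀ i, tx i ∈ square 0 D) (hrx : ∀ i, rx i ∈ square L D) :
    2 / 5 * N ^ 2 * (G / L ^ 2) ≤
      ((channelMatrix G wl tx rx)ᴴ * channelMatrix G wl tx rx).trace.re := by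
  have hL0 : 0 < L := by linarith
  rw [trace_conjTranspose_mul_self_re]
  calc 2 / 5 * N ^ 2 * (G / L ^ 2) = ∑ k : Fin N, ∑ i : Fin N, 2 / 5 * (G / L ^ 2) := by
        simp; ring
    _ ≤ _ := by
        refine Finset.sum_le_sum fun k _ => Finset.sum_le_sum fun i _ => ?_
        obtain ⟨h1, h2⟩ := dist_le_of_mem_square hD hL (htx k) (hrx i)
        have hd : 0 < dist (rx i) (tx k) := by linarith
        rw [channelMatrix, Matrix.of_apply, neg_mul, ← neg_mul, norm_ofReal_mul_exp, sq_abs,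
          div_pow, Real.sq_sqrt hG.le, div_mul_div_comm, div_le_div_iff₀ (by positivity)
          (by positivity)]
        nlinarith

/-- The node positions are good: they lie in the squares and the Gram matrix of the channel has a
small Frobenius norm. -/
def GoodNodes (D L wl : ℝ) (z : (Fin N → Plane) × (Fin N → Plane)) : Prop :=
  (∀ i, z.1 i ∈ square 0 D) ∧ (∀ i, z.2 i ∈ square L D) ∧
    gramSum L wl z.1 z.2 ≤ 214812 * N ^ 4 * max (1 / (N : ℝ)) (dofM D L wl)⁻¹

lemma nodeLaw_not_goodNodes_le (hD : 0 < D) (hL : 2 * D ≤ L) (hwl : 0 < wl) (hN : 0 < N) :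
    nodeLaw N D L {z | ¬ GoodNodes D L wl z} ≤ ENNReal.ofReal (96 / √N) := by
  have := isProbabilityMeasure_uniformLaw 0 hD
  have := isProbabilityMeasure_uniformLaw L hD
  have h1 : ∀ᵐ z ∂(nodeLaw N D L), ∀ i, z.1 i ∈ square 0 D :=
    Measure.quasiMeasurePreserving_fst.ae (ae_all_iff.2 fun i =>
      (Measure.quasiMeasurePreserving_eval (fun _ : Fin N => uniformLaw (square 0 D)) i).ae
        (ae_mem_square 0 D))
  have h2 : ∀ᵐ z ∂(nodeLaw N D L), ∀ i, z.2 i ∈ square L D :=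
    Measure.quasiMeasurePreserving_snd.ae (ae_all_iff.2 fun i =>
      (Measure.quasiMeasurePreserving_eval (fun _ : Fin N => uniformLaw (square L D)) i).ae
        (ae_mem_square L D))
  refine le_trans (measure_mono_ae ?_) (nodeLaw_gramSum_gt_le (wl := wl) hD hL hwl hN)
  filter_upwards [h1, h2] with z hz1 hz2 hz
  by_contra hcon
  exact hz ⟨hz1, hz2, not_lt.1 hcon⟩

end Event
end

noncomputable section

/-! ### Variational lower bound for the divergence -/

section DonskerVaradhan

/-- One half of the Donsker-Varadhan variational formula. -/
theorem ofReal_integral_le_klDiv {Ω : Type*} [MeasurableSpace Ω] {π ν : Measure Ω}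
    [IsProbabilityMeasure π] [IsProbabilityMeasure ν] {f : Ω → ℝ} (hfm : Measurable f)
    (hf : Integrable f π) (h : ∫⁻ x, ENNReal.ofReal (Real.exp (f x)) ∂ν ≤ 1) :
    ENNReal.ofReal (∫ x, f x ∂π) ≤ InformationTheory.klDiv π ν := by
  by_cases hac : π ≪ ν
  swap
  · rw [InformationTheory.klDiv_of_not_ac hac]; exact le_top
  by_cases hint : Integrable (llr π ν) π
  swap
  · rw [InformationTheory.klDiv_of_not_integrable hint]; exact le_top
  rw [InformationTheory.klDiv_of_ac_of_integrable hac hint]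
  refine ENNReal.ofReal_le_ofReal ?_
  simp only [probReal_univ, add_sub_cancel_right]
  -- π-almost everywhere g is e^f dν/dπ, so its π-integral is at most that of e^f under ν, hence at
  -- most one. Then f - `llr π ν` ≤ g - 1 is integrated.
  set g : Ω → ℝ := fun x => Real.exp (f x - llr π ν x) with hg
  have hgm : AEStronglyMeasurable g π :=
    (Real.measurable_exp.comp (hfm.sub (measurable_llr π ν))).aestronglyMeasurable
  have hlin : ∫⁻ x, ENNReal.ofReal (g x) ∂π ≤ 1 := by
    have e : (fun x => ENNReal.ofReal (g x)) ≤ᵐ[π]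
        fun x => ν.rnDeriv π x * ENNReal.ofReal (Real.exp (f x)) := by
      filter_upwards [exp_neg_llr hac] with x hx
      simp only [hg]
      rw [sub_eq_add_neg, Real.exp_add, hx, mul_comm,
        ENNReal.ofReal_mul ENNReal.toReal_nonneg]
      gcongr
      exact ENNReal.ofReal_toReal_le
    have hm : Measurable fun x => ENNReal.ofReal (Real.exp (f x)) := by fun_prop
    calc _ ≤ ∫⁻ x, ν.rnDeriv π x * ENNReal.ofReal (Real.exp (f x)) ∂π := lintegral_mono_ae e
      _ = ∫⁻ x, ENNReal.ofReal (Real.exp (f x)) ∂(π.withDensity (ν.rnDeriv π)) :=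
          (lintegral_withDensity_eq_lintegral_mul _ (Measure.measurable_rnDeriv _ _) hm).symm
      _ ≤ ∫⁻ x, ENNReal.ofReal (Real.exp (f x)) ∂ν :=
          lintegral_mono' (Measure.withDensity_rnDeriv_le _ _) le_rfl
      _ ≤ 1 := h
  have hgi : Integrable g π := by
    refine ⟨hgm, ?_⟩
    rw [hasFiniteIntegral_iff_ofReal (ae_of_all _ fun x => (Real.exp_pos _).le)]
    exact hlin.trans_lt ENNReal.one_lt_top
  have hg1 : ∫ x, g x ∂π ≤ 1 := by
    rw [integral_eq_lintegral_of_nonneg_ae (ae_of_all _ fun x => (Real.exp_pos _).le) hgm]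
    exact ENNReal.toReal_le_of_le_ofReal zero_le_one (by simpa using hlin)
  have hle : ∫ x, (f x - llr π ν x) ∂π ≤ ∫ x, (g x - 1) ∂π :=
    integral_mono (hf.sub hint) (hgi.sub (integrable_const _)) fun x => by
      have := Real.add_one_le_exp (f x - llr π ν x)
      simp only [hg]; linarith
  rw [integral_sub hf hint, integral_sub hgi (integrable_const _)] at hle
  simp at hle
  linarith

end DonskerVaradhan

/-! ### Gaussian densities and moments -/

section ComplexGaussian

lemma measurable_complex_mk : Measurable fun p : ℝ × ℝ => (⟨p.1, p.2⟩ : ℂ) :=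
  Complex.measurableEquivRealProd.symm.measurable

instance : IsProbabilityMeasure complexGaussian :=
  Measure.isProbabilityMeasure_map measurable_complex_mk.aemeasurable

instance (N : ℕ) : IsProbabilityMeasure (gaussianNoise N) := by
  unfold gaussianNoise; infer_instance

/-- Completing the square in `z` yields the normal density of mean ay/(b + a²) and variance b/(2(b +
a²)), the law of the input conditioned on the output in the Gaussian model. -/
lemma integral_gaussianReal_density_ratio (a y : ℝ) {b : ℝ} (hb : 0 < b) :
    ∫ z, √((b + a ^ 2) / b) * Real.exp (-(y - a * z) ^ 2 / b + y ^ 2 / (b + a ^ 2))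
      ∂(gaussianReal 0 (1 / 2)) = 1 := by
  have hs : 0 < b + a ^ 2 := by positivity
  set v : ℝ≥0 := ⟨b / (2 * (b + a ^ 2)), by positivity⟩ with hv
  have hv0 : v ≠ 0 := by
    intro h
    have : (v : ℝ) = 0 := by rw [h]; rfl
    have h2 : (0 : ℝ) < b / (2 * (b + a ^ 2)) := by positivity
    exact h2.ne' this
  rw [integral_gaussianReal_eq_integral_smul (by norm_num),
    ← integral_gaussianPDFReal_eq_one (a * y / (b + a ^ 2)) hv0]
  refine integral_congr_ae (ae_of_all _ fun z => ?_)
  have hvv : (v : ℝ) = b / (2 * (b + a ^ 2)) := rfl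
  simp only [gaussianPDFReal, smul_eq_mul, hvv]
  have e1 : (√(2 * Real.pi * ((1 / 2 : ℝ≥0) : ℝ)))⁻¹ * √((b + a ^ 2) / b) =
      (√(2 * Real.pi * (b / (2 * (b + a ^ 2)))))⁻¹ := by
    rw [← Real.sqrt_inv, ← Real.sqrt_mul (by positivity), ← Real.sqrt_inv]
    congr 1
    push_cast
    field_simp
  rw [mul_mul_mul_comm, e1, ← Real.exp_add]
  congr 2
  push_cast
  field_simp
  ring

lemma integral_complexGaussian_density_ratio (a : ℝ) (y : ℂ) {b : ℝ} (hb : 0 < b) :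
    ∫ z, (b + a ^ 2) / b * Real.exp (-‖y - a * z‖ ^ 2 / b + ‖y‖ ^ 2 / (b + a ^ 2))
      ∂complexGaussian = 1 := by
  have hs : 0 < b + a ^ 2 := by positivity
  rw [complexGaussian, integral_map measurable_complex_mk.aemeasurable
    (Continuous.aestronglyMeasurable (by fun_prop))]
  have e : ∀ p : ℝ × ℝ, (b + a ^ 2) / b *
      Real.exp (-‖y - a * (⟨p.1, p.2⟩ : ℂ)‖ ^ 2 / b + ‖y‖ ^ 2 / (b + a ^ 2)) =
      (√((b + a ^ 2) / b) * Real.exp (-(y.re - a * p.1) ^ 2 / b + y.re ^ 2 / (b + a ^ 2))) *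
      (√((b + a ^ 2) / b) * Real.exp (-(y.im - a * p.2) ^ 2 / b + y.im ^ 2 / (b + a ^ 2))) := by
    intro p
    rw [mul_mul_mul_comm, Real.mul_self_sqrt (by positivity), ← Real.exp_add,
      ← Complex.normSq_eq_norm_sq, ← Complex.normSq_eq_norm_sq, Complex.normSq_apply,
      Complex.normSq_apply]
    congr 2
    simp
    ring
  simp_rw [e]
  rw [integral_prod_mul (fun x : ℝ => √((b + a ^ 2) / b) *
    Real.exp (-(y.re - a * x) ^ 2 / b + y.re ^ 2 / (b + a ^ 2))) (fun x : ℝ => √((b + a ^ 2) / b) *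
    Real.exp (-(y.im - a * x) ^ 2 / b + y.im ^ 2 / (b + a ^ 2))),
    integral_gaussianReal_density_ratio a _ hb, integral_gaussianReal_density_ratio a _ hb, mul_one]

lemma memLp_complexGaussian : MemLp (fun z : ℂ => z) 2 complexGaussian := by
  rw [complexGaussian, memLp_map_measure_iff (by fun_prop) measurable_complex_mk.aemeasurable]
  have h1 : MemLp (fun p : ℝ × ℝ => p.1) 2 ((gaussianReal 0 (1 / 2)).prod (gaussianReal 0 (1 / 2))) :=
    (memLp_id_gaussianReal 2).comp_measurePreserving measurePreserving_fst
  have h2 : MemLp (fun p : ℝ × ℝ => p.2) 2 ((gaussianReal 0 (1 / 2)).prod (gaussianReal 0 (1 / 2))) :=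
    (memLp_id_gaussianReal 2).comp_measurePreserving measurePreserving_snd
  have := h1.ofReal (K := ℂ) |>.add (h2.ofReal (K := ℂ) |>.const_mul Complex.I)
  refine this.congr_norm measurable_complex_mk.aestronglyMeasurable (ae_of_all _ fun p => ?_)
  congr 1
  apply Complex.ext <;> simp

lemma integral_id_complexGaussian : ∫ z, z ∂complexGaussian = 0 := by
  have hi := memLp_complexGaussian.integrable one_le_two
  rw [complexGaussian] at hi ⊢
  rw [integral_map measurable_complex_mk.aemeasurable (by fun_prop)]
  have h1 : Integrable (fun p : ℝ × ℝ => p.1) ((gaussianReal 0 (1 / 2)).prod (gaussianReal 0 (1 / 2))) :=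
    ((memLp_id_gaussianReal 2).comp_measurePreserving measurePreserving_fst).integrable one_le_two
  have h2 : Integrable (fun p : ℝ × ℝ => p.2) ((gaussianReal 0 (1 / 2)).prod (gaussianReal 0 (1 / 2))) :=
    ((memLp_id_gaussianReal 2).comp_measurePreserving measurePreserving_snd).integrable one_le_two
  have e : ∀ p : ℝ × ℝ, (⟨p.1, p.2⟩ : ℂ) = (p.1 : ℂ) + (p.2 : ℂ) * Complex.I := fun p =>
    Complex.mk_eq_add_mul_I _ _
  simp_rw [e]
  rw [integral_add h1.ofReal (h2.ofReal.mul_const _), integral_mul_const, integral_complex_ofReal,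
    integral_complex_ofReal, integral_prod _ h1, integral_prod _ h2]
  simp [integral_id_gaussianReal]

lemma integral_norm_sq_complexGaussian : ∫ z, ‖z‖ ^ 2 ∂complexGaussian = 1 := by
  rw [complexGaussian, integral_map measurable_complex_mk.aemeasurable (by fun_prop)]
  have h1 : Integrable (fun p : ℝ × ℝ => p.1 ^ 2)
      ((gaussianReal 0 (1 / 2)).prod (gaussianReal 0 (1 / 2))) :=
    ((memLp_id_gaussianReal 2).comp_measurePreserving measurePreserving_fst).integrable_sq
  have h2 : Integrable (fun p : ℝ × ℝ => p.2 ^ 2)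
      ((gaussianReal 0 (1 / 2)).prod (gaussianReal 0 (1 / 2))) :=
    ((memLp_id_gaussianReal 2).comp_measurePreserving measurePreserving_snd).integrable_sq
  have e : ∀ p : ℝ × ℝ, ‖(⟨p.1, p.2⟩ : ℂ)‖ ^ 2 = p.1 ^ 2 + p.2 ^ 2 := fun p => by
    rw [← Complex.normSq_eq_norm_sq, Complex.normSq_apply]; ring
  have hv : ∫ x, x ^ 2 ∂(gaussianReal 0 (1 / 2)) = 1 / 2 := by
    have h := variance_id_gaussianReal (μ := 0) (v := 1 / 2)
    rw [variance_eq_sub (memLp_id_gaussianReal 2)] at h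
    simpa [integral_id_gaussianReal] using h
  simp_rw [e]
  rw [integral_add h1 h2, integral_prod _ h1, integral_prod _ h2]
  simp only [integral_const, probReal_univ, one_smul, hv]
  norm_num

variable {N : ℕ}

lemma memLp_gaussianNoise (i : Fin N) :
    MemLp (fun z : Fin N → ℂ => z i) 2 (gaussianNoise N) :=
  memLp_complexGaussian.comp_measurePreserving
    (measurePreserving_eval (fun _ : Fin N => complexGaussian) i)

lemma integral_gaussianNoise_eval (i : Fin N) : ∫ z, z i ∂(gaussianNoise N) = 0 := by
  rw [← integral_id_complexGaussian, ← map_eval_pi (N := N) complexGaussian i,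
    integral_map (measurable_pi_apply i).aemeasurable (by fun_prop)]
  rfl

lemma integral_norm_sq_gaussianNoise_eval (i : Fin N) :
    ∫ z, ‖z i‖ ^ 2 ∂(gaussianNoise N) = 1 := by
  rw [← integral_norm_sq_complexGaussian, ← map_eval_pi (N := N) complexGaussian i,
    integral_map (measurable_pi_apply i).aemeasurable (by fun_prop)]
  rfl

lemma integral_gaussianNoise_mul_conj (i j : Fin N) :
    ∫ z, z i * (starRingEnd ℂ) (z j) ∂(gaussianNoise N) = if i = j then 1 else 0 := by
  split_ifs with h
  · subst h
    simp_rw [Complex.mul_conj, Complex.normSq_eq_norm_sq]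
    rw [integral_complex_ofReal, integral_norm_sq_gaussianNoise_eval, Complex.ofReal_one]
  · have hc : Continuous fun p : ℂ × ℂ => p.1 * (starRingEnd ℂ) p.2 :=
      continuous_fst.mul (Complex.continuous_conj.comp continuous_snd)
    have := integral_map (μ := gaussianNoise N) (φ := fun z : Fin N → ℂ => (z i, z j))
      (f := fun p : ℂ × ℂ => p.1 * (starRingEnd ℂ) p.2) (by fun_prop) hc.aestronglyMeasurable
    rw [← this, gaussianNoise, map_pair_pi _ h,
      integral_prod_mul (fun z : ℂ => z) (fun z : ℂ => (starRingEnd ℂ) z),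
      integral_id_complexGaussian, zero_mul]

end ComplexGaussian

/-! ### Second moments of linear images -/

section SecondMoments

lemma integral_norm_sq_add_prod {α β : Type*} [MeasurableSpace α] [MeasurableSpace β]
    {μ : Measure α} {ν : Measure β} [IsProbabilityMeasure μ] [IsProbabilityMeasure ν]
    {f : α → ℂ} {g : β → ℂ} (hf : MemLp f 2 μ) (hg : MemLp g 2 ν) (hg0 : ∫ y, g y ∂ν = 0) :
    ∫ p, ‖f p.1 + g p.2‖ ^ 2 ∂(μ.prod ν) = ∫ x, ‖f x‖ ^ 2 ∂μ + ∫ y, ‖g y‖ ^ 2 ∂ν := by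
  have hf' := hf.comp_measurePreserving (measurePreserving_fst (μ := μ) (ν := ν))
  have hg' := hg.comp_measurePreserving (measurePreserving_snd (μ := μ) (ν := ν))
  have i1 : Integrable (fun p : α × β => ‖f p.1‖ ^ 2) (μ.prod ν) := hf'.norm.integrable_sq
  have i2 : Integrable (fun p : α × β => ‖g p.2‖ ^ 2) (μ.prod ν) := hg'.norm.integrable_sq
  have i3 : Integrable (fun p : α × β => f p.1 * (starRingEnd ℂ) (g p.2)) (μ.prod ν) :=
    (hf.integrable one_le_two).mul_prod (f := f) (g := fun y => (starRingEnd ℂ) (g y))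
      ((Complex.conjLIE.integrable_comp_iff).2 (hg.integrable one_le_two))
  have e : ∀ p : α × β, ‖f p.1 + g p.2‖ ^ 2 =
      ‖f p.1‖ ^ 2 + ‖g p.2‖ ^ 2 + 2 * (f p.1 * (starRingEnd ℂ) (g p.2)).re := fun p => by
    rw [← Complex.normSq_eq_norm_sq, ← Complex.normSq_eq_norm_sq, ← Complex.normSq_eq_norm_sq,
      Complex.normSq_add]
  have hre : ∫ p : α × β, (f p.1 * (starRingEnd ℂ) (g p.2)).re ∂(μ.prod ν) = 0 := by
    have := integral_re i3
    simp only [RCLike.re_to_complex] at this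
    rw [this, integral_prod_mul f (fun y => (starRingEnd ℂ) (g y)), integral_conj, hg0]
    simp
  have i4 : Integrable (fun p : α × β => 2 * (f p.1 * (starRingEnd ℂ) (g p.2)).re) (μ.prod ν) :=
    i3.re.const_mul 2
  have i5 : Integrable (fun p : α × β => ‖f p.1‖ ^ 2 + ‖g p.2‖ ^ 2) (μ.prod ν) := i1.add i2
  simp_rw [e]
  rw [integral_add i5 i4, integral_add i1 i2, integral_const_mul, hre,
    integral_prod _ i1, integral_prod _ i2]
  simp

lemma integral_norm_sq_linear {Ω ι : Type*} [Fintype ι] [MeasurableSpace Ω] {μ : Measure Ω}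
    {f : ι → Ω → ℂ} (hf : ∀ i, MemLp (f i) 2 μ) (c : ι → ℂ) :
    ∫ x, ‖∑ i, c i * f i x‖ ^ 2 ∂μ =
      (∑ i, ∑ j, c i * (∫ x, f i x * (starRingEnd ℂ) (f j x) ∂μ) * (starRingEnd ℂ) (c j)).re := by
  have hi : ∀ i j, Integrable (fun x => f i x * (starRingEnd ℂ) (f j x)) μ := fun i j =>
    (hf i).integrable_mul (hf j).star
  have e : ∀ x, ((‖∑ i, c i * f i x‖ ^ 2 : ℝ) : ℂ) =
      ∑ i, ∑ j, c i * (f i x * (starRingEnd ℂ) (f j x)) * (starRingEnd ℂ) (c j) := fun x => by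
    rw [← Complex.normSq_eq_norm_sq, ← Complex.mul_conj, map_sum, Finset.sum_mul_sum]
    refine Finset.sum_congr rfl fun i _ => Finset.sum_congr rfl fun j _ => ?_
    rw [map_mul]; ring
  rw [← Complex.ofReal_re (∫ x, ‖∑ i, c i * f i x‖ ^ 2 ∂μ), ← integral_complex_ofReal]
  simp_rw [e]
  rw [integral_finsetSum _ fun i _ => integrable_finsetSum _ fun j _ =>
    ((hi i j).const_mul _).mul_const _]
  congr 1
  refine Finset.sum_congr rfl fun i _ => ?_
  rw [integral_finsetSum _ fun j _ => ((hi i j).const_mul _).mul_const _]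
  refine Finset.sum_congr rfl fun j _ => ?_
  rw [integral_mul_const, integral_const_mul]

variable {N : ℕ}

lemma integral_norm_sq_conjTranspose_mulVec {μW : Measure (Fin N → ℂ)} [IsProbabilityMeasure μW]
    (hW : ∀ i, MemLp (fun w : Fin N → ℂ => w i) 2 μW) (U : Matrix (Fin N) (Fin N) ℂ) (i : Fin N) :
    ∫ w, ‖(Uᴴ *ᵥ (w - fun j => ∫ v, v j ∂μW)) i‖ ^ 2 ∂μW = ((Uᴴ * covMatrix μW * U) i i).re := by
  have hf : ∀ j, MemLp (fun w : Fin N → ℂ => w j - ∫ v, v j ∂μW) 2 μW := fun j =>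
    (hW j).sub (memLp_const _)
  have h := integral_norm_sq_linear hf (fun j => (starRingEnd ℂ) (U j i))
  simp only [Matrix.mulVec, dotProduct, Matrix.conjTranspose_apply, Pi.sub_apply,
    Matrix.mul_apply, covMatrix, Matrix.of_apply, RCLike.star_def, Finset.sum_mul]
  rw [h, Finset.sum_comm]
  simp

lemma integral_norm_sq_conjTranspose_mulVec_gaussianNoise (U : Matrix (Fin N) (Fin N) ℂ)
    (i : Fin N) :
    ∫ z, ‖(Uᴴ *ᵥ z) i‖ ^ 2 ∂(gaussianNoise N) = ∑ j, ‖U j i‖ ^ 2 := by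
  have h := integral_norm_sq_linear (memLp_gaussianNoise (N := N))
    (fun j => (starRingEnd ℂ) (U j i))
  simp only [Matrix.mulVec, dotProduct, Matrix.conjTranspose_apply, RCLike.star_def]
  rw [h]
  simp only [integral_gaussianNoise_mul_conj, Complex.conj_conj, mul_ite, mul_one, mul_zero,
    ite_mul, zero_mul, Finset.sum_ite_eq, Finset.mem_univ, if_true]
  rw [Complex.re_sum]
  refine Finset.sum_congr rfl fun j _ => ?_
  rw [mul_comm, Complex.mul_conj, Complex.ofReal_re, Complex.normSq_eq_norm_sq]

lemma memLp_mulVec {Ω : Type*} [MeasurableSpace Ω] {μ : Measure Ω} {f : Ω → Fin N → ℂ}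
    (hf : ∀ j, MemLp (fun x => f x j) 2 μ) (A : Matrix (Fin N) (Fin N) ℂ) (i : Fin N) :
    MemLp (fun x => (A *ᵥ f x) i) 2 μ := by
  simp only [Matrix.mulVec, dotProduct]
  exact memLp_finsetSum _ fun j _ => (hf j).const_mul _

lemma integral_mulVec_eq_zero {Ω : Type*} [MeasurableSpace Ω] {μ : Measure Ω} [IsFiniteMeasure μ]
    {f : Ω → Fin N → ℂ} (hf : ∀ j, MemLp (fun x => f x j) 2 μ) (h0 : ∀ j, ∫ x, f x j ∂μ = 0)
    (A : Matrix (Fin N) (Fin N) ℂ) (i : Fin N) : ∫ x, (A *ᵥ f x) i ∂μ = 0 := by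
  simp only [Matrix.mulVec, dotProduct]
  rw [integral_finsetSum _ fun j _ => ((hf j).integrable one_le_two).const_mul _]
  simp [integral_const_mul, h0]

end SecondMoments
end

noncomputable section

/-! ### Information bound for arbitrary interference -/

section MutualInformation

variable {N : ℕ} (H A A' U : Matrix (Fin N) (Fin N) ℂ) (s b : Fin N → ℝ)
  (μW : Measure (Fin N → ℂ))

/-- The logarithm of the ratio of the Gaussian conditional and marginal densities of the rotated
channel output `η`, given the decoded input `z`. -/
def logDensityRatio (z η : Fin N → ℂ) : ℝ :=
  ∑ i, (Real.log ((b i + s i ^ 2) / b i) +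
    (-‖η i - s i * z i‖ ^ 2 / b i + ‖η i‖ ^ 2 / (b i + s i ^ 2)))

instance (ρ : Measure (Fin N → ℂ)) [IsProbabilityMeasure ρ] : SFinite (ρ.prod (gaussianNoise N)) :=
  Measure.prod.instSFinite

lemma continuous_logDensityRatio {X : Type*} [TopologicalSpace X] {f g : X → Fin N → ℂ}
    (hf : Continuous f) (hg : Continuous g) :
    Continuous fun x => logDensityRatio s b (f x) (g x) := by
  unfold logDensityRatio; fun_prop

variable {b} in
-- For each fixed `η` the ratio is a probability density in `z` relative to the Gaussian input. No
-- law of the output enters, which makes the test function admissible for every interference.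
lemma lintegral_exp_logDensityRatio (hb : ∀ i, 0 < b i) (η : Fin N → ℂ) :
    ∫⁻ z, ENNReal.ofReal (Real.exp (logDensityRatio s b z η)) ∂(gaussianNoise N) = 1 := by
  have e : ∀ z : Fin N → ℂ, Real.exp (logDensityRatio s b z η) =
      ∏ i, ((b i + s i ^ 2) / b i *
        Real.exp (-‖η i - s i * z i‖ ^ 2 / b i + ‖η i‖ ^ 2 / (b i + s i ^ 2))) := fun z => by
    rw [logDensityRatio, Real.exp_sum]
    refine Finset.prod_congr rfl fun i _ => ?_
    have := hb i
    rw [Real.exp_add, Real.exp_log (by positivity)]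
  have h1 : ∫ z, Real.exp (logDensityRatio s b z η) ∂(gaussianNoise N) = 1 := by
    simp_rw [e]
    rw [gaussianNoise, integral_fintype_prod_eq_prod (fun i (z : ℂ) => (b i + s i ^ 2) / b i *
        Real.exp (-‖η i - s i * z‖ ^ 2 / b i + ‖η i‖ ^ 2 / (b i + s i ^ 2)))]
    exact Finset.prod_eq_one fun i _ => integral_complexGaussian_density_ratio _ _ (hb i)
  have hi : Integrable (fun z => Real.exp (logDensityRatio s b z η)) (gaussianNoise N) :=
    integrable_of_integral_eq_one h1
  rw [← ofReal_integral_eq_lintegral_ofReal hi (ae_of_all _ fun _ => (Real.exp_pos _).le), h1,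
    ENNReal.ofReal_one]

/-- The rotated and centered noise. -/
def rotatedNoise (p : (Fin N → ℂ) × (Fin N → ℂ)) (i : Fin N) : ℂ :=
  (Uᴴ *ᵥ (p.1 - fun j => ∫ v, v j ∂μW)) i + (Uᴴ *ᵥ p.2) i

variable {μW} [IsProbabilityMeasure μW] (hW : ∀ i, MemLp (fun w : Fin N → ℂ => w i) 2 μW)

include hW in
lemma integral_sub_mean (j : Fin N) :
    ∫ w, (w - fun j => ∫ v, v j ∂μW) j ∂μW = 0 := by
  simp only [Pi.sub_apply]
  rw [integral_sub ((hW j).integrable one_le_two) (integrable_const _)]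
  simp

include hW in
lemma memLp_rotatedNoise (i : Fin N) :
    MemLp (fun p => rotatedNoise U μW p i) 2 (μW.prod (gaussianNoise N)) := by
  have h1 := memLp_mulVec (f := fun w : Fin N → ℂ => w - fun j => ∫ v, v j ∂μW)
    (fun j => (hW j).sub (memLp_const _)) Uᴴ i
  have h2 := memLp_mulVec (f := fun w : Fin N → ℂ => w) (memLp_gaussianNoise (N := N)) Uᴴ i
  exact (h1.comp_measurePreserving measurePreserving_fst).add
    (h2.comp_measurePreserving measurePreserving_snd)

include hW in
lemma integral_rotatedNoise (i : Fin N) :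
    ∫ p, rotatedNoise U μW p i ∂(μW.prod (gaussianNoise N)) = 0 := by
  have h1 := memLp_mulVec (f := fun w : Fin N → ℂ => w - fun j => ∫ v, v j ∂μW)
    (fun j => (hW j).sub (memLp_const _)) Uᴴ i
  have h2 := memLp_mulVec (f := fun w : Fin N → ℂ => w) (memLp_gaussianNoise (N := N)) Uᴴ i
  have i1 : Integrable (fun p : (Fin N → ℂ) × (Fin N → ℂ) =>
      (Uᴴ *ᵥ (p.1 - fun j => ∫ v, v j ∂μW)) i) (μW.prod (gaussianNoise N)) :=
    (h1.comp_measurePreserving measurePreserving_fst).integrable one_le_two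
  have i2 : Integrable (fun p : (Fin N → ℂ) × (Fin N → ℂ) => (Uᴴ *ᵥ p.2) i)
      (μW.prod (gaussianNoise N)) :=
    (h2.comp_measurePreserving measurePreserving_snd).integrable one_le_two
  simp only [rotatedNoise]
  rw [integral_add i1 i2, integral_prod _ i1, integral_prod _ i2]
  simp only [integral_const, probReal_univ, one_smul]
  rw [integral_mulVec_eq_zero (f := fun w : Fin N → ℂ => w - fun j => ∫ v, v j ∂μW)
    (fun j => (hW j).sub (memLp_const _)) (integral_sub_mean hW),
    integral_mulVec_eq_zero (f := fun w : Fin N → ℂ => w) memLp_gaussianNoise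
      integral_gaussianNoise_eval, zero_add]

include hW in
lemma integral_norm_sq_rotatedNoise (i : Fin N) :
    ∫ p, ‖rotatedNoise U μW p i‖ ^ 2 ∂(μW.prod (gaussianNoise N)) =
      ((Uᴴ * covMatrix μW * U) i i).re + ∑ j, ‖U j i‖ ^ 2 := by
  have h1 := memLp_mulVec (f := fun w : Fin N → ℂ => w - fun j => ∫ v, v j ∂μW)
    (fun j => (hW j).sub (memLp_const _)) Uᴴ i
  have h2 := memLp_mulVec (f := fun w : Fin N → ℂ => w) (memLp_gaussianNoise (N := N)) Uᴴ i
  simp only [rotatedNoise]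
  rw [integral_norm_sq_add_prod h1 h2 (integral_mulVec_eq_zero (f := fun w : Fin N → ℂ => w)
    memLp_gaussianNoise integral_gaussianNoise_eval _ _),
    integral_norm_sq_conjTranspose_mulVec hW,
    integral_norm_sq_conjTranspose_mulVec_gaussianNoise]

include hW in
/-- The expected log-density ratio is at least the Gaussian mutual information. -/
lemma integral_logDensityRatio_ge (hb : ∀ i, 0 < b i)
    (hn : ∀ i, ((Uᴴ * covMatrix μW * U) i i).re + ∑ j, ‖U j i‖ ^ 2 ≤ b i) :
    Integrable (fun r : (Fin N → ℂ) × ((Fin N → ℂ) × (Fin N → ℂ)) =>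
      logDensityRatio s b r.1 fun i => s i * r.1 i + rotatedNoise U μW r.2 i)
      ((gaussianNoise N).prod (μW.prod (gaussianNoise N))) ∧
    ∑ i, Real.log ((b i + s i ^ 2) / b i) ≤
      ∫ r, (logDensityRatio s b r.1 fun i => s i * r.1 i + rotatedNoise U μW r.2 i)
        ∂((gaussianNoise N).prod (μW.prod (gaussianNoise N))) := by
  have hz : ∀ i, MemLp (fun z : Fin N → ℂ => (s i : ℂ) * z i) 2 (gaussianNoise N) := fun i =>
    (memLp_gaussianNoise i).const_mul _
  have hN := memLp_rotatedNoise U hW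
  have i1 : ∀ i, Integrable (fun r : (Fin N → ℂ) × ((Fin N → ℂ) × (Fin N → ℂ)) =>
      ‖rotatedNoise U μW r.2 i‖ ^ 2) ((gaussianNoise N).prod (μW.prod (gaussianNoise N))) :=
    fun i => ((hN i).comp_measurePreserving measurePreserving_snd).norm.integrable_sq
  have i2 : ∀ i, Integrable (fun r : (Fin N → ℂ) × ((Fin N → ℂ) × (Fin N → ℂ)) =>
      ‖(s i : ℂ) * r.1 i + rotatedNoise U μW r.2 i‖ ^ 2)
        ((gaussianNoise N).prod (μW.prod (gaussianNoise N))) :=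
    fun i => (((hz i).comp_measurePreserving measurePreserving_fst).add
      ((hN i).comp_measurePreserving measurePreserving_snd)).norm.integrable_sq
  have i4 : ∀ i, Integrable (fun r : (Fin N → ℂ) × ((Fin N → ℂ) × (Fin N → ℂ)) =>
      -‖rotatedNoise U μW r.2 i‖ ^ 2 / b i)
        ((gaussianNoise N).prod (μW.prod (gaussianNoise N))) := fun i => (i1 i).neg.div_const _
  have i5 : ∀ i, Integrable (fun r : (Fin N → ℂ) × ((Fin N → ℂ) × (Fin N → ℂ)) =>
      ‖(s i : ℂ) * r.1 i + rotatedNoise U μW r.2 i‖ ^ 2 / (b i + s i ^ 2))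
        ((gaussianNoise N).prod (μW.prod (gaussianNoise N))) := fun i => (i2 i).div_const _
  have i3 : ∀ i, Integrable (fun r : (Fin N → ℂ) × ((Fin N → ℂ) × (Fin N → ℂ)) =>
      Real.log ((b i + s i ^ 2) / b i) + (-‖rotatedNoise U μW r.2 i‖ ^ 2 / b i +
        ‖(s i : ℂ) * r.1 i + rotatedNoise U μW r.2 i‖ ^ 2 / (b i + s i ^ 2)))
        ((gaussianNoise N).prod (μW.prod (gaussianNoise N))) := fun i =>
    (integrable_const _).add ((i4 i).add (i5 i))
  simp only [logDensityRatio, add_sub_cancel_left]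
  refine ⟨integrable_finsetSum _ fun i _ => i3 i, ?_⟩
  rw [integral_finsetSum _ fun i _ => i3 i]
  refine Finset.sum_le_sum fun i _ => ?_
  have hbi := hb i
  have hbs : 0 < b i + s i ^ 2 := by positivity
  set n := ((Uᴴ * covMatrix μW * U) i i).re + ∑ j, ‖U j i‖ ^ 2 with hndef
  have e1 : ∫ r : (Fin N → ℂ) × ((Fin N → ℂ) × (Fin N → ℂ)), ‖rotatedNoise U μW r.2 i‖ ^ 2
      ∂((gaussianNoise N).prod (μW.prod (gaussianNoise N))) = n := by
    rw [integral_prod _ (i1 i), hndef, ← integral_norm_sq_rotatedNoise U hW i]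
    simp
  have e2 : ∫ r : (Fin N → ℂ) × ((Fin N → ℂ) × (Fin N → ℂ)),
      ‖(s i : ℂ) * r.1 i + rotatedNoise U μW r.2 i‖ ^ 2
      ∂((gaussianNoise N).prod (μW.prod (gaussianNoise N))) = s i ^ 2 + n := by
    rw [integral_norm_sq_add_prod (hz i) (hN i) (integral_rotatedNoise U hW i),
      integral_norm_sq_rotatedNoise U hW i]
    simp [mul_pow, integral_const_mul, integral_norm_sq_gaussianNoise_eval, hndef]
  have i6 : Integrable (fun r : (Fin N → ℂ) × ((Fin N → ℂ) × (Fin N → ℂ)) =>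
      -‖rotatedNoise U μW r.2 i‖ ^ 2 / b i +
        ‖(s i : ℂ) * r.1 i + rotatedNoise U μW r.2 i‖ ^ 2 / (b i + s i ^ 2))
        ((gaussianNoise N).prod (μW.prod (gaussianNoise N))) := (i4 i).add (i5 i)
  rw [integral_add (integrable_const _) i6, integral_add (i4 i) (i5 i), integral_div, integral_div,
    integral_neg, e1, e2]
  simp only [integral_const, probReal_univ, one_smul]
  -- This quantity is nonincreasing in n and vanishes at n = b i, so overestimating the noise
  -- variance costs nothing here.
  have h0 : 0 ≤ -n / b i + (s i ^ 2 + n) / (b i + s i ^ 2) := by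
    rw [div_add_div _ _ hbi.ne' hbs.ne']
    refine div_nonneg ?_ (by positivity)
    nlinarith [mul_nonneg (sq_nonneg (s i)) (sub_nonneg.2 (hn i))]
  linarith

include hW in
/-- A lower bound for the information between a linearly precoded Gaussian input and the output of
the channel, for an arbitrary interference law. -/
theorem ofReal_sum_log_le_klDiv_jointLaw (hA : A' * A = 1)
    (hU : Uᴴ * H * A = Matrix.diagonal fun i => (s i : ℂ)) (hb : ∀ i, 0 < b i)
    (hn : ∀ i, ((Uᴴ * covMatrix μW * U) i i).re + ∑ j, ‖U j i‖ ^ 2 ≤ b i) :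
    ENNReal.ofReal (∑ i, Real.log ((b i + s i ^ 2) / b i)) ≤
      InformationTheory.klDiv (jointLaw H μW ((gaussianNoise N).map fun z => A *ᵥ z))
        ((jointLaw H μW ((gaussianNoise N).map fun z => A *ᵥ z)).fst.prod
          (jointLaw H μW ((gaussianNoise N).map fun z => A *ᵥ z)).snd) := by
  have hAc : Continuous fun z : Fin N → ℂ => A *ᵥ z := by fun_prop
  have hA'c : Continuous fun z : Fin N → ℂ => A' *ᵥ z := by fun_prop
  have hHc : Continuous fun z : Fin N → ℂ => H *ᵥ z := by fun_prop
  have hUc : Continuous fun z : Fin N → ℂ => Uᴴ *ᵥ z := by fun_prop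
  set μX := (gaussianNoise N).map fun z => A *ᵥ z with hμX
  have : IsProbabilityMeasure μX := Measure.isProbabilityMeasure_map hAc.measurable.aemeasurable
  set π := jointLaw H μW μX with hπ
  have hprob : IsProbabilityMeasure (μW.prod (gaussianNoise N)) := inferInstance
  have hprob' : IsProbabilityMeasure (μX.prod (μW.prod (gaussianNoise N))) := inferInstance
  have hch : Measurable fun q : (Fin N → ℂ) × ((Fin N → ℂ) × (Fin N → ℂ)) =>
      (q.1, H *ᵥ q.1 + q.2.1 + q.2.2) :=
    Continuous.measurable (continuous_fst.prodMk
      (((hHc.comp continuous_fst).add (continuous_fst.comp continuous_snd)).add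
        (continuous_snd.comp continuous_snd)))
  have : IsProbabilityMeasure π := Measure.isProbabilityMeasure_map hch.aemeasurable
  have hfst : π.fst = μX := by
    rw [hπ, jointLaw, Measure.fst, Measure.map_map measurable_fst hch]
    exact measurePreserving_fst.map_eq
  have : IsProbabilityMeasure π.snd := inferInstance
  let m : Fin N → ℂ := fun j => ∫ v, v j ∂μW
  let f : (Fin N → ℂ) × (Fin N → ℂ) → ℝ := fun p =>
    logDensityRatio s b (A' *ᵥ p.1) (Uᴴ *ᵥ (p.2 - m))
  have hfc : Continuous f := continuous_logDensityRatio s b (hA'c.comp continuous_fst)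
    (hUc.comp (continuous_snd.sub continuous_const))
  have hAA : ∀ z, A' *ᵥ (A *ᵥ z) = z := fun z => by rw [Matrix.mulVec_mulVec, hA, Matrix.one_mulVec]
  -- Under the product of the marginals the output can be fixed while the input is integrated; `A'`
  -- recovers the Gaussian vector from the input.
  have hexp : ∫⁻ p, ENNReal.ofReal (Real.exp (f p)) ∂(π.fst.prod π.snd) ≤ 1 := by
    rw [hfst, lintegral_prod_symm' _ (by fun_prop)]
    calc _ = ∫⁻ y, 1 ∂π.snd := by
          refine lintegral_congr fun y => ?_
          rw [hμX, lintegral_map (by fun_prop) hAc.measurable]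
          simp only [f, hAA]
          exact lintegral_exp_logDensityRatio s hb _
      _ ≤ 1 := by simp
  have hπ' : π = ((gaussianNoise N).prod (μW.prod (gaussianNoise N))).map
      fun r => (A *ᵥ r.1, H *ᵥ (A *ᵥ r.1) + r.2.1 + r.2.2) := by
    have hp : μX.prod (μW.prod (gaussianNoise N)) =
        ((gaussianNoise N).prod (μW.prod (gaussianNoise N))).map
          (Prod.map (fun z => A *ᵥ z) id) := by
      rw [← Measure.map_prod_map _ _ hAc.measurable measurable_id, Measure.map_id]
    rw [hπ, jointLaw, hp, Measure.map_map hch (hAc.measurable.prodMap measurable_id)]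
    rfl
  have hgm : Measurable fun r : (Fin N → ℂ) × ((Fin N → ℂ) × (Fin N → ℂ)) =>
      (A *ᵥ r.1, H *ᵥ (A *ᵥ r.1) + r.2.1 + r.2.2) :=
    Continuous.measurable ((hAc.comp continuous_fst).prodMk
      (((hHc.comp (hAc.comp continuous_fst)).add (continuous_fst.comp continuous_snd)).add
        (continuous_snd.comp continuous_snd)))
  have hfg : ∀ r : (Fin N → ℂ) × ((Fin N → ℂ) × (Fin N → ℂ)),
      f (A *ᵥ r.1, H *ᵥ (A *ᵥ r.1) + r.2.1 + r.2.2) =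
        logDensityRatio s b r.1 fun i => s i * r.1 i + rotatedNoise U μW r.2 i := fun r => by
    simp only [f, hAA]
    congr 1
    funext i
    have e : H *ᵥ (A *ᵥ r.1) + r.2.1 + r.2.2 - m = H *ᵥ (A *ᵥ r.1) + ((r.2.1 - m) + r.2.2) := by
      abel
    rw [e, Matrix.mulVec_add, Matrix.mulVec_add, Matrix.mulVec_mulVec, Matrix.mulVec_mulVec,
      hU, Pi.add_apply, Pi.add_apply, Matrix.mulVec_diagonal]
    rfl
  obtain ⟨hint, hge⟩ := integral_logDensityRatio_ge U s b hW hb hn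
  have hfint : Integrable f π := by
    rw [hπ', integrable_map_measure hfc.aestronglyMeasurable hgm.aemeasurable]
    exact hint.congr (ae_of_all _ fun r => (hfg r).symm)
  refine le_trans (ENNReal.ofReal_le_ofReal ?_)
    (ofReal_integral_le_klDiv hfc.measurable hfint hexp)
  rw [hπ', integral_map hgm.aemeasurable hfc.aestronglyMeasurable]
  simp only [hfg]
  exact hge

include hW in
/-- The corresponding lower bound for the capacity. -/
theorem ofReal_sum_logb_le_capacity {P : ℝ} (hP : ∀ i, ∑ j, ‖A i j‖ ^ 2 ≤ P) (hA : A' * A = 1)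
    (hU : Uᴴ * H * A = Matrix.diagonal fun i => (s i : ℂ)) (hb : ∀ i, 0 < b i)
    (hn : ∀ i, ((Uᴴ * covMatrix μW * U) i i).re + ∑ j, ‖U j i‖ ^ 2 ≤ b i) :
    ENNReal.ofReal (∑ i, Real.logb 2 ((b i + s i ^ 2) / b i)) ≤ capacity H μW P := by
  have hAc : Continuous fun z : Fin N → ℂ => A *ᵥ z := by fun_prop
  have hprob : IsProbabilityMeasure ((gaussianNoise N).map fun z => A *ᵥ z) :=
    Measure.isProbabilityMeasure_map hAc.measurable.aemeasurable
  refine le_trans ?_ (le_iSup_of_le ((gaussianNoise N).map fun z => A *ᵥ z)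
    (le_iSup_of_le hprob (le_iSup_of_le ?_ le_rfl)))
  · rw [mutualInfo, ENNReal.le_div_iff_mul_le (Or.inl (by simp [Real.log_pos one_lt_two]))
      (Or.inl ENNReal.ofReal_ne_top), ← ENNReal.ofReal_mul' (Real.log_nonneg one_le_two),
      Finset.sum_mul]
    refine le_trans (le_of_eq ?_) (ofReal_sum_log_le_klDiv_jointLaw H A A' U s b hW hA hU hb hn)
    congr 1
    refine Finset.sum_congr rfl fun i _ => ?_
    rw [Real.logb, div_mul_cancel₀ _ (Real.log_pos one_lt_two).ne']
  · intro i
    have hmem := memLp_mulVec (f := fun z : Fin N → ℂ => z) (memLp_gaussianNoise (N := N)) A i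
    rw [lintegral_map (by fun_prop) hAc.measurable]
    have e : ∀ z : Fin N → ℂ, ‖(A *ᵥ z) i‖ₑ ^ 2 = ENNReal.ofReal (‖(A *ᵥ z) i‖ ^ 2) := fun z => by
      rw [ENNReal.ofReal_pow (norm_nonneg _), ofReal_norm]
    simp_rw [e]
    rw [← ofReal_integral_eq_lintegral_ofReal hmem.norm.integrable_sq
      (ae_of_all _ fun _ => sq_nonneg _)]
    refine ENNReal.ofReal_le_ofReal (le_trans (le_of_eq ?_) (hP i))
    have := integral_norm_sq_conjTranspose_mulVec_gaussianNoise Aᴴ i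
    simpa using this

end MutualInformation
end

noncomputable section

/-! ### Reduction to parallel channels -/

section Diagonalization

variable {N : ℕ}

lemma conjTranspose_mul_covMatrix_mul_nonneg {μW : Measure (Fin N → ℂ)} [IsProbabilityMeasure μW]
    (hW : ∀ i, MemLp (fun w : Fin N → ℂ => w i) 2 μW) (U : Matrix (Fin N) (Fin N) ℂ) (i : Fin N) :
    0 ≤ ((Uᴴ * covMatrix μW * U) i i).re := by
  rw [← integral_norm_sq_conjTranspose_mulVec hW]
  exact integral_nonneg fun _ => sq_nonneg _

lemma trace_covMatrix_nonneg {μW : Measure (Fin N → ℂ)} [IsProbabilityMeasure μW]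
    (hW : ∀ i, MemLp (fun w : Fin N → ℂ => w i) 2 μW) : 0 ≤ (covMatrix μW).trace.re := by
  rw [Matrix.trace, Complex.re_sum]
  refine Finset.sum_nonneg fun i _ => ?_
  simpa using conjTranspose_mul_covMatrix_mul_nonneg hW 1 i

/-- Bessel's inequality for the covariance matrix and a partial isometry `U`. -/
lemma sum_conjTranspose_mul_covMatrix_mul_le {μW : Measure (Fin N → ℂ)} [IsProbabilityMeasure μW]
    (hW : ∀ i, MemLp (fun w : Fin N → ℂ => w i) 2 μW) {U : Matrix (Fin N) (Fin N) ℂ}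
    (hU : U * (Uᴴ * U) = U) :
    ∑ i, ((Uᴴ * covMatrix μW * U) i i).re ≤ (covMatrix μW).trace.re := by
  -- The complementary projection compresses the covariance to a matrix of nonnegative trace, and
  -- that trace is the difference of the two sides.
  have hQ : (1 - U * Uᴴ) * (1 - U * Uᴴ)ᴴ = 1 - U * Uᴴ := by
    have : U * Uᴴ * (U * Uᴴ) = U * Uᴴ := by
      rw [← Matrix.mul_assoc, Matrix.mul_assoc U, hU]
    rw [Matrix.conjTranspose_sub, Matrix.conjTranspose_mul, Matrix.conjTranspose_conjTranspose,
      Matrix.conjTranspose_one, Matrix.mul_sub, Matrix.sub_mul, Matrix.sub_mul, this]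
    simp
  have h0 : 0 ≤ ((1 - U * Uᴴ)ᴴ * covMatrix μW * (1 - U * Uᴴ)).trace.re := by
    rw [Matrix.trace, Complex.re_sum]
    exact Finset.sum_nonneg fun i _ => conjTranspose_mul_covMatrix_mul_nonneg hW _ i
  rw [Matrix.mul_assoc, Matrix.trace_mul_comm, Matrix.mul_assoc, hQ, Matrix.mul_sub,
    Matrix.mul_one, Matrix.trace_sub, ← Matrix.mul_assoc, Matrix.trace_mul_comm,
    ← Matrix.mul_assoc, Complex.sub_re] at h0
  rw [← Complex.re_sum]
  exact sub_nonneg.1 h0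

open scoped ComplexOrder in
/-- The capacity of the channel in terms of the eigenvalues of `H^* H`. -/
theorem exists_eigenvalues_sum_logb_le_capacity (H : Matrix (Fin N) (Fin N) ℂ) :
    ∃ e : Fin N → ℝ, (∀ i, 0 ≤ e i) ∧ ∑ i, e i = (Hᴴ * H).trace.re ∧
      ∑ i, e i ^ 2 = ∑ k, ∑ l, ‖(Hᴴ * H) k l‖ ^ 2 ∧
      ∀ μW : Measure (Fin N → ℂ), IsProbabilityMeasure μW →
        (∀ i, MemLp (fun w : Fin N → ℂ => w i) 2 μW) →
        ∃ σ : Fin N → ℝ, (∀ i, 0 ≤ σ i) ∧ ∑ i, σ i ≤ (covMatrix μW).trace.re ∧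
          ∀ P : ℝ, 0 < P →
            ENNReal.ofReal (∑ i, Real.logb 2 (1 + P * e i / (1 + σ i))) ≤ capacity H μW P := by
  have hG : (Hᴴ * H).IsHermitian := Matrix.isHermitian_conjTranspose_mul_self H
  set e := hG.eigenvalues with he
  have he0 : ∀ i, 0 ≤ e i := (Matrix.posSemidef_conjTranspose_mul_self H).eigenvalues_nonneg
  set V : Matrix (Fin N) (Fin N) ℂ := (hG.eigenvectorUnitary : Matrix (Fin N) (Fin N) ℂ) with hV
  have hVV : Vᴴ * V = 1 := Matrix.mem_unitaryGroup_iff'.1 hG.eigenvectorUnitary.2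
  have hVV' : V * Vᴴ = 1 := Matrix.mem_unitaryGroup_iff.1 hG.eigenvectorUnitary.2
  have hspec : Hᴴ * H = V * Matrix.diagonal (fun i => (e i : ℂ)) * Vᴴ := by
    have := hG.spectral_theorem
    rw [Unitary.conjStarAlgAut_apply] at this
    exact this
  have hdiag : Vᴴ * (Hᴴ * H) * V = Matrix.diagonal (fun i => (e i : ℂ)) := by
    rw [hspec, Matrix.mul_assoc, Matrix.mul_assoc, hVV, Matrix.mul_one, ← Matrix.mul_assoc, hVV,
      Matrix.one_mul]
  refine ⟨e, he0, ?_, ?_, ?_⟩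
  · rw [hspec, Matrix.trace_mul_comm, ← Matrix.mul_assoc, hVV, Matrix.one_mul,
      Matrix.trace_diagonal, Complex.re_sum]
    simp
  · have h1 := trace_conjTranspose_mul_self_re (Hᴴ * H)
    rw [Finset.sum_comm, hG.eq] at h1
    rw [← h1, hspec]
    have : V * Matrix.diagonal (fun i => (e i : ℂ)) * Vᴴ *
        (V * Matrix.diagonal (fun i => (e i : ℂ)) * Vᴴ) =
        V * (Matrix.diagonal (fun i => (e i : ℂ)) * Matrix.diagonal (fun i => (e i : ℂ))) * Vᴴ := by
      simp only [Matrix.mul_assoc]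
      rw [← Matrix.mul_assoc Vᴴ V, hVV, Matrix.one_mul]
    rw [this, Matrix.trace_mul_comm, ← Matrix.mul_assoc, hVV, Matrix.one_mul,
      Matrix.diagonal_mul_diagonal, Matrix.trace_diagonal, Complex.re_sum]
    refine Finset.sum_congr rfl fun i _ => ?_
    rw [← Complex.ofReal_mul, Complex.ofReal_re, sq]
  · intro μW hprob hW
    -- As `0⁻¹ = 0`, the columns of `U` at zero eigenvalues vanish. Thus `U` is a partial isometry
    -- even for singular `H`, and its columns have norm at most one.
    set c : Fin N → ℝ := fun i => (√(e i))⁻¹ with hc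
    set U : Matrix (Fin N) (Fin N) ℂ := H * V * Matrix.diagonal (fun i => (c i : ℂ)) with hUdef
    have hUH : Uᴴ = Matrix.diagonal (fun i => (c i : ℂ)) * Vᴴ * Hᴴ := by
      rw [hUdef, Matrix.conjTranspose_mul, Matrix.conjTranspose_mul, Matrix.diagonal_conjTranspose,
        Matrix.mul_assoc]
      congr 2
      funext i
      simp
    have hUHV : Uᴴ * H * V = Matrix.diagonal (fun i => ((c i * e i : ℝ) : ℂ)) := by
      rw [hUH]
      have : Matrix.diagonal (fun i => (c i : ℂ)) * Vᴴ * Hᴴ * H * V =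
          Matrix.diagonal (fun i => (c i : ℂ)) * (Vᴴ * (Hᴴ * H) * V) := by
        simp only [Matrix.mul_assoc]
      rw [this, hdiag, Matrix.diagonal_mul_diagonal]
      simp
    have hUU : Uᴴ * U = Matrix.diagonal (fun i => ((c i * e i * c i : ℝ) : ℂ)) := by
      nth_rewrite 2 [hUdef]
      rw [← Matrix.mul_assoc, ← Matrix.mul_assoc, hUHV, Matrix.diagonal_mul_diagonal]
      simp
    have hce : ∀ i, c i * e i * c i * c i = c i ∧ c i * e i * c i ≤ 1 ∧ c i * e i = √(e i) := by
      intro i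
      rcases (he0 i).eq_or_lt with h | h
      · simp [hc, ← h]
      · have hs := Real.sqrt_pos.2 h
        have hs2 := Real.mul_self_sqrt h.le
        have h3 : c i * e i = √(e i) := by
          rw [hc]; field_simp; rw [sq, hs2]
        have h4 : c i * e i * c i = 1 := by rw [h3, hc]; field_simp
        exact ⟨by rw [h4, one_mul], h4.le, h3⟩
    have hUUU : U * (Uᴴ * U) = U := by
      rw [hUU]
      nth_rewrite 1 [hUdef]
      rw [Matrix.mul_assoc, Matrix.diagonal_mul_diagonal, hUdef]
      congr 2
      funext i
      rw [← Complex.ofReal_mul, mul_comm, (hce i).1]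
    have hUn : ∀ i, ∑ j, ‖U j i‖ ^ 2 ≤ 1 := by
      intro i
      have h1 : ((Uᴴ * U) i i).re = ∑ j, ‖U j i‖ ^ 2 := by
        rw [Matrix.mul_apply, Complex.re_sum]
        refine Finset.sum_congr rfl fun j _ => ?_
        rw [Matrix.conjTranspose_apply, RCLike.star_def, mul_comm, Complex.mul_conj,
          Complex.normSq_eq_norm_sq, Complex.ofReal_re]
      rw [← h1, hUU, Matrix.diagonal_apply_eq, Complex.ofReal_re]
      exact (hce i).2.1
    have hσ0 := conjTranspose_mul_covMatrix_mul_nonneg hW U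
    refine ⟨fun i => ((Uᴴ * covMatrix μW * U) i i).re, hσ0,
      sum_conjTranspose_mul_covMatrix_mul_le hW hUUU, fun P hP => ?_⟩
    have hsP := Real.sqrt_pos.2 hP
    have hsP0 : ((√P : ℝ) : ℂ) ≠ 0 := Complex.ofReal_ne_zero.2 hsP.ne'
    -- The rows of the unitary `V` have norm one, so the precoder √P V meets each antenna's power
    -- constraint with equality.
    have key := ofReal_sum_logb_le_capacity (P := P) H (((√P : ℝ) : ℂ) • V)
      ((((√P : ℝ) : ℂ))⁻¹ • Vᴴ) U (fun i => √P * √(e i))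
      (fun i => 1 + ((Uᴴ * covMatrix μW * U) i i).re) hW ?_ ?_ ?_ ?_ ?_
    · refine le_trans (le_of_eq ?_) key
      congr 1
      refine Finset.sum_congr rfl fun i _ => ?_
      have : 0 < 1 + ((Uᴴ * covMatrix μW * U) i i).re := by linarith [hσ0 i]
      congr 1
      rw [mul_pow, Real.sq_sqrt hP.le, Real.sq_sqrt (he0 i), add_div, div_self this.ne']
    · intro i
      have h1 : ((V * Vᴴ) i i).re = ∑ j, ‖V i j‖ ^ 2 := by
        rw [Matrix.mul_apply, Complex.re_sum]
        refine Finset.sum_congr rfl fun j _ => ?_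
        rw [Matrix.conjTranspose_apply, RCLike.star_def, Complex.mul_conj,
          Complex.normSq_eq_norm_sq, Complex.ofReal_re]
      rw [hVV', Matrix.one_apply_eq, Complex.one_re] at h1
      simp only [Matrix.smul_apply, smul_eq_mul, norm_mul, mul_pow, ← Finset.mul_sum, ← h1,
        Complex.norm_real, Real.norm_eq_abs, sq_abs, Real.sq_sqrt hP.le, mul_one, le_refl]
    · rw [Matrix.smul_mul, Matrix.mul_smul, smul_smul, inv_mul_cancel₀ hsP0, one_smul, hVV]
    · rw [Matrix.mul_smul, hUHV]
      ext i j
      by_cases hij : i = j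
      · subst hij
        rw [Matrix.smul_apply, Matrix.diagonal_apply_eq, Matrix.diagonal_apply_eq, smul_eq_mul,
          (hce i).2.2, Complex.ofReal_mul]
      · simp [Matrix.diagonal_apply_ne _ hij]
    · intro i; linarith [hσ0 i]
    · intro i; linarith [hUn i]

end Diagonalization

/-! ### Counting good channels -/

section Rate

/-- A Paley-Zygmund bound for a sum of rates. -/
lemma mul_logb_le_sum_logb {N : ℕ} (hN : 0 < N) {r σ : Fin N → ℝ} (hr : ∀ i, 0 ≤ r i)
    (hσ : ∀ i, 0 ≤ σ i) {s κ δ Q : ℝ} (hs0 : 0 ≤ s) (hκ0 : 0 ≤ κ) (hs : ∑ i, σ i ≤ N * s)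
    (hκ : N * κ ≤ ∑ i, r i) (hQ0 : 0 < Q) (hQ : ∑ i, r i ^ 2 ≤ N * Q) (hδ : 0 ≤ δ)
    (ht : 1 ≤ (1 + (1 - δ) * (s + κ)) / (1 + s)) :
    N * (δ ^ 2 * (s + κ) ^ 2 / Q) * Real.logb 2 ((1 + (1 - δ) * (s + κ)) / (1 + s)) ≤
      ∑ i, Real.logb 2 (1 + r i / (1 + σ i)) := by
  have hNpos : (0 : ℝ) < N := by exact_mod_cast hN
  have h1s : 0 < 1 + s := by linarith
  set t := (1 + (1 - δ) * (s + κ)) / (1 + s) with htdef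
  have htm : t * (1 + s) = 1 + (1 - δ) * (s + κ) := div_mul_cancel₀ _ h1s.ne'
  -- Off `S`, r_i ≤ (t - 1)(1 + σ_i). Since (t - 1)(1 + s) = (1 - δ)(s + κ) - s by the choice of
  -- `t`, subtracting these amounts from ∑ r_i ≥ Nκ leaves at least Nδ(s + κ) on `S`. Cauchy-Schwarz
  -- then bounds the size of `S` from below.
  set S : Finset (Fin N) := Finset.univ.filter fun i => (t - 1) * (1 + σ i) < r i with hS
  have hV : N * (δ * (s + κ)) ≤ ∑ i ∈ S, r i := by
    have h1 : N * (δ * (s + κ)) ≤ ∑ i, (r i - (t - 1) * (1 + σ i)) := by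
      rw [Finset.sum_sub_distrib, ← Finset.mul_sum, Finset.sum_add_distrib]
      simp only [Finset.sum_const, Finset.card_univ, Fintype.card_fin, nsmul_eq_mul, mul_one]
      have h2 : (t - 1) * (N + ∑ i, σ i) ≤ (t - 1) * (N + N * s) := by
        gcongr
      have h3 : (t - 1) * (N + N * s) = N * (1 + (1 - δ) * (s + κ)) - N * (1 + s) := by
        rw [← htm]; ring
      nlinarith
    refine h1.trans ?_
    rw [hS, Finset.sum_filter]
    refine Finset.sum_le_sum fun i _ => ?_
    split_ifs with h
    · have : 0 ≤ (t - 1) * (1 + σ i) := mul_nonneg (by linarith) (by linarith [hσ i])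
      linarith
    · linarith
  have hcs : (∑ i ∈ S, r i) ^ 2 ≤ S.card * (N * Q) := by
    refine (sq_sum_le_card_mul_sum_sq (s := S) (f := r)).trans ?_
    gcongr
    exact (Finset.sum_le_univ_sum_of_nonneg fun i => sq_nonneg (r i)).trans hQ
  have hcard : N * (δ ^ 2 * (s + κ) ^ 2 / Q) ≤ S.card := by
    have h1 : (N * (δ * (s + κ))) ^ 2 ≤ S.card * (N * Q) :=
      (pow_le_pow_left₀ (by positivity) hV 2).trans hcs
    rw [← mul_div_assoc, div_le_iff₀ hQ0]
    refine le_of_mul_le_mul_left ?_ hNpos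
    linarith
  have hlog : 0 ≤ Real.logb 2 t := Real.logb_nonneg one_lt_two ht
  calc _ ≤ S.card * Real.logb 2 t := by gcongr
    _ = ∑ i ∈ S, Real.logb 2 t := by rw [Finset.sum_const, nsmul_eq_mul]
    _ ≤ ∑ i ∈ S, Real.logb 2 (1 + r i / (1 + σ i)) := by
        refine Finset.sum_le_sum fun i hi => ?_
        have h1 : 0 < 1 + σ i := by linarith [hσ i]
        refine Real.logb_le_logb_of_le one_lt_two (by linarith) ?_
        have h2 := (Finset.mem_filter.1 hi).2
        rw [← lt_div_iff₀ h1] at h2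
        linarith
    _ ≤ _ := by
        refine Finset.sum_le_univ_sum_of_nonneg fun i => Real.logb_nonneg one_lt_two ?_
        have h1 : 0 ≤ r i / (1 + σ i) := div_nonneg (hr i) (by linarith [hσ i])
        linarith

/-- The counting bound with r_i = P e_i and g = GP/L²: s = gρ₁ because Ngρ₁ = tr Σ, κ = (2/5)gN from
the trace of the Gram matrix, and Q = 214812 g² max(N², N³/M) from its Frobenius norm. -/
lemma rateBound_le_capacity {N : ℕ} (hN : 0 < N) {D L wl G P : ℝ} (hD : 0 < D) (hL : 2 * D ≤ L)
    (hG : 0 < G) (hP : 0 < P) {z : (Fin N → Plane) × (Fin N → Plane)}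
    (hz : GoodNodes D L wl z) (μW : Measure (Fin N → ℂ)) (hprob : IsProbabilityMeasure μW)
    (hW : ∀ i, MemLp (fun w : Fin N → ℂ => w i) 2 μW) {δ : ℝ} (hδ0 : 0 ≤ δ)
    (hδ1 : δ ≤ 1) :
    ENNReal.ofReal (rateBound (2 / 5) 214812 δ (rho1 (covMatrix μW) L G P)
      (rho2 (covMatrix μW) L G P) N (dofM D L wl) (G * P / L ^ 2)) ≤
        capacity (channelMatrix G wl z.1 z.2) μW P := by
  have hL0 : 0 < L := by linarith
  have hNpos : (0 : ℝ) < N := by exact_mod_cast hN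
  have hM1 := one_le_dofM D L wl
  obtain ⟨htx, hrx, hgram⟩ := hz
  obtain ⟨e, he0, htr, hsq, hcap⟩ :=
    exists_eigenvalues_sum_logb_le_capacity (channelMatrix G wl z.1 z.2)
  obtain ⟨σ, hσ0, hσ, hcap⟩ := hcap μW hprob hW
  refine le_trans (ENNReal.ofReal_le_ofReal ?_) (hcap P hP)
  have htr' := trace_gram_channelMatrix_ge (wl := wl) hD hL hG htx hrx
  rw [sum_norm_sq_gram_channelMatrix hD hL hG htx hrx] at hsq
  rw [← htr] at htr'
  set g := G * P / L ^ 2 with hg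
  have hg0 : 0 < g := by positivity
  set ρ := rho1 (covMatrix μW) L G P with hρ
  set ρ' := rho2 (covMatrix μW) L G P with hρ'
  set M := dofM D L wl with hM
  have hNs : N * (g * ρ) = (covMatrix μW).trace.re := by
    rw [hρ, rho1, hg]; field_simp
  have hs0 : 0 ≤ g * ρ := by
    have := trace_covMatrix_nonneg hW
    rw [← hNs] at this
    exact nonneg_of_mul_nonneg_right this hNpos
  have hρ0 : 0 ≤ ρ := nonneg_of_mul_nonneg_right hs0 hg0
  set m := max ((N : ℝ) ^ 2) (N ^ 3 * M⁻¹) with hm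
  have hm0 : 0 < m := lt_max_of_lt_left (by positivity)
  have hmax : (N : ℝ) ^ 4 * max (1 / (N : ℝ)) M⁻¹ = N * m := by
    rw [hm, mul_max_of_nonneg _ _ (by positivity), mul_max_of_nonneg _ _ hNpos.le]
    congr 1
    · field_simp
    · ring
  have harg : 1 + g * ((1 - δ) * (2 / 5) * N - δ * ρ) / (1 + g * ρ) =
      (1 + (1 - δ) * (g * ρ + g * (2 / 5 * N))) / (1 + g * ρ) := by
    have : 1 + g * ρ ≠ 0 := by linarith
    field_simp
    ring
  have hnonneg : 0 ≤ ∑ i, Real.logb 2 (1 + P * e i / (1 + σ i)) :=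
    Finset.sum_nonneg fun i _ => Real.logb_nonneg one_lt_two (by
      have : 0 ≤ P * e i / (1 + σ i) := div_nonneg (mul_nonneg hP.le (he0 i)) (by linarith [hσ0 i])
      linarith)
  rw [rateBound, harg]
  set t := (1 + (1 - δ) * (g * ρ + g * (2 / 5 * N))) / (1 + g * ρ) with ht
  rcases le_total 1 t with h1t | h1t
  · refine le_trans ?_ (mul_logb_le_sum_logb hN (r := fun i => P * e i) (σ := σ)
      (s := g * ρ) (κ := g * (2 / 5 * N)) (δ := δ) (Q := g ^ 2 * (214812 * m))
      (fun i => mul_nonneg hP.le (he0 i)) hσ0 hs0 (by positivity) (hσ.trans_eq hNs.symm) ?_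
      (by positivity) ?_ hδ0 h1t)
    · have hlog : 0 ≤ Real.logb 2 t := Real.logb_nonneg one_lt_two h1t
      have e1 : δ ^ 2 * (g * ρ + g * (2 / 5 * N)) ^ 2 / (g ^ 2 * (214812 * m)) =
          δ ^ 2 * (ρ + 2 / 5 * N) ^ 2 / (214812 * m) := by
        rw [← mul_add, mul_pow, mul_left_comm, mul_div_mul_left _ _ (by positivity)]
      rw [e1]
      -- The term ρ₂ only enlarges the denominator; the argument uses the interference through its
      -- trace alone.
      have hden : 214812 * m ≤ (√ρ' + √(214812 * m)) ^ 2 := by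
        have h2 : 0 ≤ √ρ' := Real.sqrt_nonneg _
        have h3 : √(214812 * m) ^ 2 = 214812 * m := Real.sq_sqrt (by positivity)
        nlinarith [Real.sqrt_nonneg (214812 * m)]
      gcongr
    · rw [← Finset.mul_sum]
      calc (N : ℝ) * (g * (2 / 5 * N)) = P * (2 / 5 * N ^ 2 * (G / L ^ 2)) := by rw [hg]; ring
        _ ≤ _ := by gcongr
    · simp only [mul_pow]
      rw [← Finset.mul_sum, hsq]
      calc P ^ 2 * ((G / L ^ 2) ^ 2 * gramSum L wl z.1 z.2) ≤
          P ^ 2 * ((G / L ^ 2) ^ 2 * (214812 * N ^ 4 * max (1 / (N : ℝ)) M⁻¹)) := by gcongr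
        _ = P ^ 2 * ((G / L ^ 2) ^ 2 * (214812 * (N ^ 4 * max (1 / (N : ℝ)) M⁻¹))) := by ring
        _ = _ := by rw [hmax, hg]; ring
  -- When the logarithm is nonpositive, so is the claimed bound, while the sum of rates is
  -- nonnegative.
  · refine le_trans (mul_nonpos_of_nonneg_of_nonpos (by positivity) ?_) hnonneg
    have h1s : 0 < 1 + g * ρ := by linarith
    have h1δ : 0 ≤ 1 - δ := by linarith
    exact Real.logb_nonpos one_lt_two (by positivity) h1t

end Rate
end

theorem theorem5 :
    ∃ K₁ K₂ : ℝ, 0 < K₁ ∧ 0 < K₂ ∧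
      ∀ ε : ℝ, 0 < ε → ∃ N₀ : ℕ, ∀ N : ℕ, N₀ ≤ N →
        ∀ D L wl G P : ℝ, 0 < D → 2 * D ≤ L → 0 < wl → 0 < G → 0 < P →
          nodeLaw N D L
            {z | ¬ ∀ μW : Measure (Fin N → ℂ), IsProbabilityMeasure μW →
                (∀ i, MemLp (fun w : Fin N → ℂ => w i) 2 μW) →
                ∀ δ : ℝ, 0 ≤ δ → δ ≤ 1 →
                  ENNReal.ofReal
                      (rateBound K₁ K₂ δ (rho1 (covMatrix μW) L G P) (rho2 (covMatrix μW) L G P)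
                        N (dofM D L wl) (G * P / L ^ 2)) ≤
                    capacity (channelMatrix G wl z.1 z.2) μW P} ≤
            ENNReal.ofReal ε := by
  refine ⟨2 / 5, 214812, by norm_num, by norm_num, fun ε hε => ?_⟩
  -- This makes 96/√N ≤ ε whatever the other parameters; the added one ensures N > 0.
  refine ⟨⌈(96 / ε) ^ 2⌉₊ + 1, fun N hN D L wl G P hD hL hwl hG hP => ?_⟩
  have hN0 : 0 < N := by omega
  -- Monotonicity needs no measurability of the exceptional set, which is defined by a quantifier
  -- over all interference laws.
  refine (measure_mono ?_).trans ((nodeLaw_not_goodNodes_le hD hL hwl hN0).trans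
    (ENNReal.ofReal_le_ofReal ?_))
  · intro z hz hgood
    exact hz fun μW hprob hW δ hδ0 hδ1 =>
      rateBound_le_capacity hN0 hD hL hG hP hgood μW hprob hW hδ0 hδ1
  · have h1 : (96 / ε) ^ 2 ≤ N := by
      refine (Nat.le_ceil _).trans ?_
      exact_mod_cast (Nat.le_succ _).trans hN
    have h2 : 96 / ε ≤ √N := Real.le_sqrt_of_sq_le h1
    have h3 : 0 < √(N : ℝ) := Real.sqrt_pos.2 (by exact_mod_cast hN0)
    rw [div_le_iff₀ hε] at h2
    rw [div_le_iff₀ h3]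
    linarith
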